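/- **Model (Coded Radio Network with decoding threshold $\kappa\ge 2$, an integer).** Time is divided into slots $0,1,2,\dots$. In each slot a set of packets in the system broadcasts. A slot is *silent* if nobody broadcasts, *good* if at least $1$ and at most $\kappa$ packets broadcast, and *bad* otherwise. A *decoding event* occurs at the end of a slot $t$ if some window of consecutive slots that ends with $t$ begins with a good slot, contains no earlier decoding event, and has at least $j$ good slots, where $j$ is the number of packets that broadcast in its good slots; the packets that broadcast in the good slots of such a window are then delivered and leave the system. The system is empty before slot $0$. At the beginning of each slot an adversary injects packets; their number may depend arbitrarily on which packets broadcast in the earlier slots. **Decodable Backoff Algorithm.** Arriving packets are inactive (joining probability $p_j=0$); an inactive packet becomes active, with $p_j=1/\sqrt\kappa$, at the end of the first silent slot that it hears (possibly its arrival slot). Time is divided into epochs. At the beginning of an epoch each packet $j$ joins it with probability $p_j$, with independent coins; the packets that joined broadcast in every slot of the epoch, and the others stay silent. The epoch ends with a silent slot (silent epoch), with a decoding event (successful epoch), or after $\kappa$ slots without a decoding event (overfull epoch). At its end every active packet still in the system multiplies $p_j$ by $\kappa^{1/4}$ if the epoch was silent, divides it by $\kappa^{1/4}$ if it was overfull,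 and keeps it if it was successful. **Theorem.** For every $c\in\mathbb N$ there is a constant $C>0$, depending only on $c$, such that the following holds for all integers $\kappa\ge 2$ and $w\ge 16\kappa^2$ and every adversary such that, almost surely, every window of $w$ consecutive slots contains at most $\bigl(1-\frac{5}{\ln\kappa}\bigr)w$ packet arrivals. (i) For every slot $t$, with probability at least $1-C/w^{c}$, the number of packets in the system in slot $t$ is at most $2w$. (ii) For every packet (given by its arrival slot and its index among the arrivals of that slot), with probability at least $1-C/w^{c}$, if the packet arrives then it is delivered within $C\sqrt{\kappa}\,w\ln^3 w$ slots. -/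

import Mathlib

open MeasureTheory

namespace CodedRadio

/-- A packet is named by the slot in which it arrives and its index among the packets arriving
in that slot. -/
abbrev Packet := ℕ × ℕ

/-! ### The Coded Radio Network Model

A slot is described by the set of packets that broadcast in it. A list of consecutive slots is
written with the most recent slot first. -/

/-- A slot is good if at least one and at most `κ` packets broadcast in it. -/
def IsGood (κ : ℕ) (B : Finset Packet) : Prop := 1 ≤ B.card ∧ B.card ≤ κ

instance (κ : ℕ) (B : Finset Packet) : Decidable (IsGood κ B) :=
  inferInstanceAs (Decidable (1 ≤ B.card ∧ B.card ≤ κ))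

/-- The good slots among the slots of `W`. -/
def goodSlots (κ : ℕ) (W : List (Finset Packet)) : List (Finset Packet) :=
  W.filter fun B => IsGood κ B

/-- The packets that broadcast in at least one good slot of `W`. -/
def goodPackets (κ : ℕ) (W : List (Finset Packet)) : Finset Packet :=
  (goodSlots κ W).foldr (· ∪ ·) ∅

/-- Let `log` be the list of all slots after the last decoding event, up to the current slot.
`W` is a decoding window if it is a window of these slots (so it contains no earlier decoding
event) that ends with the current slot (the head of `log`), begins with a good slot (the last
entry of `W`), and has at least as many good slots as there are packets that broadcast in its
good slots. -/
structure IsDecodingWindow (κ : ℕ) (log W : List (Finset Packet)) : Prop where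
  ends_now : W <+: log
  begins_good : ∃ B, W.getLast? = some B ∧ IsGood κ B
  enough : (goodPackets κ W).card ≤ (goodSlots κ W).length

/-- A decoding event happens in the current slot, given the slots `log` since the last one. -/
def DecodingEvent (κ : ℕ) (log : List (Finset Packet)) : Prop :=
  ∃ W, IsDecodingWindow κ log W

open Classical in
/-- The packets received by the base station in the current slot: those that broadcast in a good
slot of a decoding window. If there are several decoding windows, the longest one contains all
the others, so that these are the packets of the longest one. -/
noncomputable def decoded (κ : ℕ) (log : List (Finset Packet)) : Finset Packet :=
  (goodPackets κ log).filter fun j => ∃ W, IsDecodingWindow κ log W ∧ j ∈ goodPackets κ W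

/-! ### The Decodable Backoff Algorithm -/

/-- What a slot means for the current epoch: the epoch goes on, or it ends as a silent, a
successful or an overfull epoch. -/
inductive Outcome where
  | ongoing
  | silent
  | successful
  | overfull

open Classical in
/-- The outcome of a slot with broadcasters `B`, where `log` lists the slots since the last
decoding event, including the current one, and `elapsed` is the number of slots of the epoch,
including the current one. -/
noncomputable def outcome (κ : ℕ) (B : Finset Packet) (log : List (Finset Packet))
    (elapsed : ℕ) : Outcome :=
  if B = ∅ then .silent
  else if DecodingEvent κ log then .successful
  else if κ ≤ elapsed then .overfull
  else .ongoing

open Classical in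
/-- The update of a joining probability after a slot. Inactive packets have joining
probability `0`; they become active, with joining probability `1 / √κ`, when they hear a silent
slot. -/
noncomputable def updateProb (κ : ℕ) (p : ℝ) : Outcome → ℝ
  | .ongoing => p
  | .silent => if p = 0 then 1 / √(κ : ℝ) else p * (κ : ℝ) ^ (1 / 4 : ℝ)
  | .successful => p
  | .overfull => p / (κ : ℝ) ^ (1 / 4 : ℝ)

/-- The state of the system between two slots. -/
structure State where
  /-- the packets in the system -/
  system : Finset Packet
  /-- the joining probabilities; a packet in the system is active if it is not `0` -/
  prob : Packet → ℝ
  /-- the packets that joined the current epoch (irrelevant if `elapsed = 0`) -/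
  joined : Finset Packet
  /-- the number of slots of the current epoch so far; it is `0` if a new epoch is to begin -/
  elapsed : ℕ
  /-- the broadcasters of the slots since the last decoding event, most recent first -/
  log : List (Finset Packet)
  /-- the broadcasters of all slots so far, most recent first -/
  history : List (Finset Packet)

/-- The empty system before slot `0`. -/
def State.init : State where
  system := ∅
  prob := fun _ => 0
  joined := ∅
  elapsed := 0
  log := []
  history := []

/-- An adaptive adversary: it decides how many packets to inject at the beginning of a slot from
the sets of packets that broadcast in the earlier slots (most recent first; the length of the
list is the number of the slot). -/
abbrev Adversary := List (Finset Packet) → ℕ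

/-- The packets in the system in slot `t`: those left over and those injected in the slot. -/
def State.present (s : State) (A : Adversary) (t : ℕ) : Finset Packet :=
  s.system ∪ (Finset.range (A s.history)).image fun k => (t, k)

open Classical in
/-- The packets that broadcast in slot `t`. If a new epoch begins, each packet `j` in the system
joins it if its coin `u j` is less than its joining probability; otherwise the packets that
joined the current epoch broadcast. -/
noncomputable def State.broadcasters (s : State) (A : Adversary) (t : ℕ)
    (u : Packet → unitInterval) : Finset Packet :=
  if s.elapsed = 0 then (s.present A t).filter fun j => (u j : ℝ) < s.prob j else s.joined

/-- The packets that are decoded, and leave the system, at the end of slot `t`. -/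
noncomputable def State.delivered (s : State) (κ : ℕ) (A : Adversary) (t : ℕ)
    (u : Packet → unitInterval) : Finset Packet :=
  decoded κ (s.broadcasters A t u :: s.log)

/-- The outcome of slot `t` for the current epoch. -/
noncomputable def State.slotOutcome (s : State) (κ : ℕ) (A : Adversary) (t : ℕ)
    (u : Packet → unitInterval) : Outcome :=
  outcome κ (s.broadcasters A t u) (s.broadcasters A t u :: s.log) (s.elapsed + 1)

open Classical in
/-- One slot of the algorithm. -/
noncomputable def State.step (s : State) (κ : ℕ) (A : Adversary) (t : ℕ)
    (u : Packet → unitInterval) : State where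
  system := s.present A t \ s.delivered κ A t u
  prob := fun j => if j ∈ s.present A t \ s.delivered κ A t u then
    updateProb κ (s.prob j) (s.slotOutcome κ A t u) else 0
  joined := s.broadcasters A t u
  elapsed := match s.slotOutcome κ A t u with
    | .ongoing => s.elapsed + 1
    | _ => 0
  log := if DecodingEvent κ (s.broadcasters A t u :: s.log) then []
    else s.broadcasters A t u :: s.log
  history := s.broadcasters A t u :: s.history

/-- The coins: one number in `[0, 1]` for each slot and each packet. -/
abbrev Coins := ℕ × Packet → unitInterval

/-- The coins are independent and uniformly distributed on `[0, 1]`. -/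
noncomputable def coinMeasure : Measure Coins :=
  Measure.infinitePi fun _ => (volume : Measure unitInterval)

/-- The state before slot `t`. -/
noncomputable def run (κ : ℕ) (A : Adversary) (ω : Coins) : ℕ → State
  | 0 => State.init
  | t + 1 => (run κ A ω t).step κ A t fun j => ω (t, j)

/-- The number of packets that arrive in slot `t`. -/
noncomputable def arrivals (κ : ℕ) (A : Adversary) (ω : Coins) (t : ℕ) : ℕ :=
  A (run κ A ω t).history

/-- The packets in the system in slot `t`, after the arrivals and before the departures. -/
noncomputable def inSystem (κ : ℕ) (A : Adversary) (ω : Coins) (t : ℕ) : Finset Packet :=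
  (run κ A ω t).present A t

/-- The packets delivered in slot `t`. -/
noncomputable def deliveredIn (κ : ℕ) (A : Adversary) (ω : Coins) (t : ℕ) : Finset Packet :=
  (run κ A ω t).delivered κ A t fun j => ω (t, j)

end CodedRadio

open CodedRadio

/-!
Write `x = ln κ` and `q = κ ^ (1 / 4)`. If `x < 5`, the arrival rate is negative and there is
nothing to prove; otherwise `κ ≥ exp 5 > 144`.

An epoch with `N` joining packets is simple: for `N = 0` it takes one silent slot, for
`1 ≤ N ≤ κ` it takes `N` slots and delivers all `N` packets, for `N > κ` it takes `κ` slots and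
delivers nothing (`State.Inv.slotCase`). So slots are lost only in silent and in overfull epochs.
Overfull epochs are rare, because each of them divides the contention by `q`: the expected number
of overfull epochs that a contention `X` calls for is `log_q (2 X / q ^ 3)`, and the contention is
driven up only by the activation of new packets, which can pay a price of order
`1 / (q x)` per packet for this (`activation_le`), by silence although `X > √κ / 2`, or by silence
while `X` is small, which costs nothing. Silent epochs in turn are
bounded by overfull epochs, because a silent epoch multiplies all joining probabilities by `q`: with
the bound `D` on the depth of the active packets (`depth`), each silent epoch decreases `D` by one,
unless `D = 2`. In the latter case either few packets are in the system, or most of them are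
inactive and their price pays for the slot (`State.Inv.potential_step_of_prob_ge`).

Altogether the number of packets plus `D` plus the price and the cost of the contention decreases
by one in each slot, up to arrivals, idle silent slots and atypical slots
(`LegalHistory.balance_cons_le`). A gain of `3 / x` per slot makes up for the atypical slots, even
in exponential moments (`atypical_le`), so that the exponential of the `balance` is a
supermartingale for every adversary (`lintegral_exp_balance_cons_le`). It is formulated along the
broadcast history, which determines the state and takes countably many values, and of which the
coins of the next slot are independent (`lintegral_hist_succ`). This gives exponential tails for
the growth of the balance between any two slots (`measure_balance_sub_ge_le`).

For the backlog, one looks back from slot `t` to the last idle slot, and sums the tail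
probabilities over all possible such slots, a geometric series (`potential_add_le`,
`measure_exists_balance_ge_le`). For the delay of a packet, the arrivals do not fill `5 w x` slots
after its arrival, hence there are many idle silent slots, and so many more silent than overfull
epochs; this would drive the joining probability of the packet above the maximum
(`netDrift_add_four_le`, `netDrift_lt_of_not_delivered`).
-/

namespace CodedRadio
open ProbabilityTheory
open scoped ENNReal

/-! ### Decoding windows of a single epoch -/

lemma goodSlots_replicate {κ : ℕ} {B : Finset Packet} (hB : IsGood κ B) (i : ℕ) :
    goodSlots κ (List.replicate i B) = List.replicate i B := by
  simp [goodSlots, hB]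

lemma goodSlots_eq_nil {κ : ℕ} {L : List (Finset Packet)} (hL : ∀ B ∈ L, ¬ IsGood κ B) :
    goodSlots κ L = [] := by
  simpa [goodSlots, List.filter_eq_nil_iff] using hL

lemma foldr_union_replicate (B : Finset Packet) (i : ℕ) :
    (List.replicate (i + 1) B).foldr (· ∪ ·) ∅ = B := by
  induction i with
  | zero => simp
  | succ i ih => rw [List.replicate_succ, List.foldr_cons, ih, Finset.union_self]

lemma goodPackets_replicate {κ : ℕ} {B : Finset Packet} (hB : IsGood κ B) {i : ℕ} (hi : 0 < i) :
    goodPackets κ (List.replicate i B) = B := by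
  obtain ⟨i, rfl⟩ := Nat.exists_eq_succ_of_ne_zero hi.ne'
  rw [goodPackets, goodSlots_replicate hB, foldr_union_replicate]

lemma goodPackets_replicate_append {κ : ℕ} {B : Finset Packet} (hB : IsGood κ B) {i : ℕ}
    (hi : 0 < i) {L : List (Finset Packet)} (hL : ∀ B ∈ L, ¬ IsGood κ B) :
    goodPackets κ (List.replicate i B ++ L) = B := by
  have : goodSlots κ (List.replicate i B ++ L) = goodSlots κ (List.replicate i B) := by
    have h := goodSlots_eq_nil hL
    simp only [goodSlots] at h ⊢
    rw [List.filter_append, h, List.append_nil]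
  rw [goodPackets, this]
  exact goodPackets_replicate hB hi

/-- If the only good slots are the latest `m` ones, a decoding window consists of some of
these. -/
lemma IsDecodingWindow.eq_replicate {κ m : ℕ} {B : Finset Packet} {L W : List (Finset Packet)}
    (hL : ∀ B ∈ L, ¬ IsGood κ B) (h : IsDecodingWindow κ (List.replicate m B ++ L) W) :
    IsGood κ B ∧ ∃ i, 0 < i ∧ i ≤ m ∧ W = List.replicate i B := by
  obtain ⟨G, hG, hgood⟩ := h.begins_good
  have hpre : W <+: List.replicate m B ∨ ∃ V, W = List.replicate m B ++ V ∧ V <+: L := by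
    obtain ⟨T, hT⟩ := h.ends_now
    rcases List.append_eq_append_iff.1 hT with ⟨V, hV, -⟩ | ⟨V, hV, hV'⟩
    · exact .inl ⟨V, hV.symm⟩
    · exact .inr ⟨V, hV, T, hV'.symm⟩
  have hmem := List.mem_of_getLast? hG
  rcases hpre with hpre | ⟨V, rfl, hV⟩
  · rw [List.prefix_replicate_iff] at hpre
    have hGB : G = B := by
      rw [hpre.2] at hmem
      exact List.eq_of_mem_replicate hmem
    subst hGB
    exact ⟨hgood, W.length, List.length_pos_of_mem hmem, hpre.1, hpre.2⟩
  · rcases List.eq_nil_or_concat V with rfl | ⟨V', x, rfl⟩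
    · simp only [List.append_nil] at hmem
      have hGB := List.eq_of_mem_replicate hmem
      subst hGB
      exact ⟨hgood, m, by simpa using List.length_pos_of_mem hmem, le_rfl, by simp⟩
    · exfalso
      simp at hG
      subst hG
      exact hL _ (hV.subset (by simp)) hgood

/-- The slots of an epoch joined by the set `B` become decodable when their number reaches the
size of `B`, and not before. -/
lemma decodingEvent_replicate_iff {κ m : ℕ} {B : Finset Packet} {L : List (Finset Packet)}
    (hL : ∀ B ∈ L, ¬ IsGood κ B) :
    DecodingEvent κ (List.replicate m B ++ L) ↔ IsGood κ B ∧ B.card ≤ m := by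
  constructor
  · rintro ⟨W, hW⟩
    obtain ⟨hB, i, hi, him, rfl⟩ := hW.eq_replicate hL
    have := hW.enough
    rw [goodPackets_replicate hB hi, goodSlots_replicate hB, List.length_replicate] at this
    exact ⟨hB, this.trans him⟩
  · rintro ⟨hB, hm⟩
    have hm0 : 0 < m := lt_of_lt_of_le hB.1 hm
    refine ⟨List.replicate m B, List.prefix_append _ _, ⟨B, ?_, hB⟩, ?_⟩
    · simp [List.getLast?_replicate, hm0.ne']
    · rwa [goodPackets_replicate hB hm0, goodSlots_replicate hB, List.length_replicate]

lemma decoded_eq_empty {κ : ℕ} {log : List (Finset Packet)} (h : ¬ DecodingEvent κ log) :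
    decoded κ log = ∅ := by
  classical
  unfold decoded
  rw [Finset.filter_eq_empty_iff]
  rintro j - ⟨W, hW, -⟩
  exact h ⟨W, hW⟩

lemma decoded_replicate {κ m : ℕ} {B : Finset Packet} {L : List (Finset Packet)}
    (hL : ∀ B ∈ L, ¬ IsGood κ B) (hB : IsGood κ B) (hm : B.card ≤ m) :
    decoded κ (List.replicate m B ++ L) = B := by
  have hm0 : 0 < m := lt_of_lt_of_le hB.1 hm
  obtain ⟨W, hW⟩ := (decodingEvent_replicate_iff hL).2 ⟨hB, hm⟩
  classical
  unfold decoded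
  rw [goodPackets_replicate_append hB hm0 hL, Finset.filter_eq_self]
  intro j hj
  refine ⟨W, hW, ?_⟩
  obtain ⟨-, i, hi, -, rfl⟩ := hW.eq_replicate hL
  rwa [goodPackets_replicate hB hi]

/-! ### The state as a function of the broadcast history -/

/-- One slot of the algorithm in which exactly the packets in `B` broadcast. -/
noncomputable def State.stepWith (s : State) (κ : ℕ) (A : Adversary) (t : ℕ)
    (B : Finset Packet) : State :=
  open Classical in
  { system := s.present A t \ decoded κ (B :: s.log)
    prob := fun j => if j ∈ s.present A t \ decoded κ (B :: s.log) then
      updateProb κ (s.prob j) (outcome κ B (B :: s.log) (s.elapsed + 1)) else 0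
    joined := B
    elapsed := match outcome κ B (B :: s.log) (s.elapsed + 1) with
      | .ongoing => s.elapsed + 1
      | _ => 0
    log := if DecodingEvent κ (B :: s.log) then [] else B :: s.log
    history := B :: s.history }

/-- The state that results from a given broadcast history. The coins influence the state only
through the history, which takes countably many values. -/
noncomputable def replay (κ : ℕ) (A : Adversary) : List (Finset Packet) → State
  | [] => State.init
  | B :: h => (replay κ A h).stepWith κ A h.length B

lemma replay_history (κ : ℕ) (A : Adversary) (h : List (Finset Packet)) :
    (replay κ A h).history = h := by
  induction h with
  | nil => rfl
  | cons B h ih => simp [replay, State.stepWith, ih]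

lemma run_eq_replay (κ : ℕ) (A : Adversary) (ω : Coins) (t : ℕ) :
    (run κ A ω t).history.length = t ∧ run κ A ω t = replay κ A (run κ A ω t).history := by
  induction t with
  | zero => exact ⟨rfl, rfl⟩
  | succ t ih =>
    obtain ⟨h1, h2⟩ := ih
    have hh : (run κ A ω (t + 1)).history =
        (run κ A ω t).broadcasters A t (fun j => ω (t, j)) :: (run κ A ω t).history := rfl
    refine ⟨by rw [hh, List.length_cons, h1], ?_⟩
    rw [hh, replay, h1, ← h2]
    rfl

/-! ### The structure of an epoch -/

/-- What holds for every reachable state before slot `t`: in particular, the slots since the last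
decoding event are those of the current epoch, preceded by slots none of which is good, and an
epoch that goes on has not yet reached its final length. -/
structure State.Inv (κ t : ℕ) (s : State) : Prop where
  fresh : ∀ j ∈ s.system, j.1 < t
  prob_nonneg : ∀ j, 0 ≤ s.prob j
  prob_eq_zero : ∀ j, j ∉ s.system → s.prob j = 0
  log_eq : ∃ L, s.log = List.replicate s.elapsed s.joined ++ L ∧ ∀ B ∈ L, ¬ IsGood κ B
  joined_active : 0 < s.elapsed → ∀ j ∈ s.joined, j ∈ s.system ∧ s.prob j ≠ 0
  joined_nonempty : 0 < s.elapsed → s.joined.Nonempty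
  elapsed_lt_card : 0 < s.elapsed → s.joined.card ≤ κ → s.elapsed < s.joined.card
  elapsed_lt : 0 < s.elapsed → κ < s.joined.card → s.elapsed < κ

/-- The sets of packets that may broadcast next: any set of active packets at the beginning of an
epoch, and the packets that joined during an epoch. -/
structure State.Legal (s : State) (B : Finset Packet) : Prop where
  active : s.elapsed = 0 → ∀ j ∈ B, j ∈ s.system ∧ s.prob j ≠ 0
  joined : 0 < s.elapsed → B = s.joined

/-- The possible courses of a slot with broadcasters `B`: the outcome for the epoch, and the
packets decoded. -/
inductive SlotCase (κ e : ℕ) (B : Finset Packet) : Outcome → Finset Packet → Prop where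
  | silent : B = ∅ → e = 0 → SlotCase κ e B .silent ∅
  | progress : IsGood κ B → e + 1 < B.card → SlotCase κ e B .ongoing ∅
  | success : IsGood κ B → e + 1 = B.card → SlotCase κ e B .successful B
  | jam : κ < B.card → e + 1 < κ → SlotCase κ e B .ongoing ∅
  | overfull : κ < B.card → e + 1 = κ → SlotCase κ e B .overfull ∅

lemma State.Inv.log_cons {κ t : ℕ} {s : State} (hs : s.Inv κ t) {B : Finset Packet}
    (hB : s.Legal B) : ∃ L, B :: s.log = List.replicate (s.elapsed + 1) B ++ L ∧
      ∀ B ∈ L, ¬ IsGood κ B := by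
  obtain ⟨L, hL, hbad⟩ := hs.log_eq
  refine ⟨L, ?_, hbad⟩
  rw [hL, List.replicate_succ, List.cons_append]
  rcases Nat.eq_zero_or_pos s.elapsed with he | he
  · simp [he]
  · rw [hB.joined he]

lemma State.Inv.slotCase {κ t : ℕ} (hκ : 2 ≤ κ) {s : State} (hs : s.Inv κ t)
    {B : Finset Packet} (hB : s.Legal B) :
    SlotCase κ s.elapsed B (outcome κ B (B :: s.log) (s.elapsed + 1)) (decoded κ (B :: s.log)) ∧
      (DecodingEvent κ (B :: s.log) ↔
        outcome κ B (B :: s.log) (s.elapsed + 1) = .successful) := by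
  obtain ⟨L, hL, hbad⟩ := hs.log_cons hB
  have hdec := decodingEvent_replicate_iff (κ := κ) (m := s.elapsed + 1) (B := B) hbad
  rw [hL, hdec]
  rcases Finset.eq_empty_or_nonempty B with hB0 | hBne
  · have he : s.elapsed = 0 := by
      by_contra he
      have := hs.joined_nonempty (Nat.pos_of_ne_zero he)
      rw [← hB.joined (Nat.pos_of_ne_zero he), hB0] at this
      simp at this
    have hng : ¬ (IsGood κ B ∧ B.card ≤ s.elapsed + 1) := by simp [IsGood, hB0]
    have hout : outcome κ B (List.replicate (s.elapsed + 1) B ++ L) (s.elapsed + 1) = .silent := by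
      simp [outcome, hB0]
    rw [decoded_eq_empty (by rwa [hdec]), hout]
    exact ⟨.silent hB0 he, by simpa using hng⟩
  · have hpos : 0 < B.card := hBne.card_pos
    rcases le_or_gt B.card κ with hle | hgt
    · have hgood : IsGood κ B := ⟨hpos, hle⟩
      have hlt : s.elapsed < B.card := by
        rcases Nat.eq_zero_or_pos s.elapsed with he | he
        · rwa [he]
        · have := hs.elapsed_lt_card he
          rw [← hB.joined he] at this
          exact this hle
      rcases Nat.lt_or_ge (s.elapsed + 1) B.card with h | h
      · have hng : ¬ (IsGood κ B ∧ B.card ≤ s.elapsed + 1) := by omega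
        have hout : outcome κ B (List.replicate (s.elapsed + 1) B ++ L) (s.elapsed + 1) =
            .ongoing := by
          have : ¬ κ ≤ s.elapsed + 1 := by omega
          rw [outcome, if_neg hBne.ne_empty, if_neg (by rwa [hdec]), if_neg this]
        rw [decoded_eq_empty (by rwa [hdec]), hout]
        exact ⟨.progress hgood h, by simpa using hng⟩
      · have hg : IsGood κ B ∧ B.card ≤ s.elapsed + 1 := ⟨hgood, h⟩
        have hout : outcome κ B (List.replicate (s.elapsed + 1) B ++ L) (s.elapsed + 1) =
            .successful := by
          rw [outcome, if_neg hBne.ne_empty, if_pos (by rwa [hdec])]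
        rw [decoded_replicate hbad hgood h, hout]
        exact ⟨.success hgood (by omega), by simpa using hg⟩
    · have hng : ¬ (IsGood κ B ∧ B.card ≤ s.elapsed + 1) := by
        rintro ⟨⟨-, h⟩, -⟩
        omega
      have hle : s.elapsed + 1 ≤ κ := by
        rcases Nat.eq_zero_or_pos s.elapsed with he | he
        · omega
        · have := hs.elapsed_lt he
          rw [← hB.joined he] at this
          exact this hgt
      rw [decoded_eq_empty (by rwa [hdec])]
      rcases Nat.lt_or_ge (s.elapsed + 1) κ with h | h
      · have hout : outcome κ B (List.replicate (s.elapsed + 1) B ++ L) (s.elapsed + 1) =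
            .ongoing := by
          rw [outcome, if_neg hBne.ne_empty, if_neg (by rwa [hdec]), if_neg (by omega)]
        rw [hout]
        exact ⟨.jam hgt h, by simpa using hng⟩
      · have hout : outcome κ B (List.replicate (s.elapsed + 1) B ++ L) (s.elapsed + 1) =
            .overfull := by
          rw [outcome, if_neg hBne.ne_empty, if_neg (by rwa [hdec]), if_pos h]
        rw [hout]
        exact ⟨.overfull hgt (by omega), by simpa using hng⟩

lemma updateProb_nonneg {κ : ℕ} {p : ℝ} (hp : 0 ≤ p) (o : Outcome) : 0 ≤ updateProb κ p o := by
  cases o <;> simp only [updateProb] <;> (try split_ifs) <;> positivity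

lemma State.mem_present {s : State} {A : Adversary} {t : ℕ} {j : Packet} :
    j ∈ s.present A t ↔ j ∈ s.system ∨ (j.1 = t ∧ j.2 < A s.history) := by
  rcases j with ⟨a, b⟩
  simp only [State.present, Finset.mem_union, Finset.mem_image, Finset.mem_range, Prod.mk.injEq]
  constructor
  · rintro (h | ⟨k, hk, rfl, rfl⟩)
    · exact .inl h
    · exact .inr ⟨rfl, hk⟩
  · rintro (h | ⟨rfl, h⟩)
    · exact .inl h
    · exact .inr ⟨b, h, rfl, rfl⟩

lemma State.Inv.stepWith {κ t : ℕ} (hκ : 2 ≤ κ) {s : State} (hs : s.Inv κ t) (A : Adversary)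
    {B : Finset Packet} (hB : s.Legal B) : (s.stepWith κ A t B).Inv κ (t + 1) := by
  classical
  obtain ⟨hcase, hdec⟩ := hs.slotCase hκ hB
  have hactive : ∀ j ∈ B, j ∈ s.system ∧ s.prob j ≠ 0 := by
    rcases Nat.eq_zero_or_pos s.elapsed with he | he
    · exact hB.active he
    · rw [hB.joined he]
      exact hs.joined_active he
  obtain ⟨L, hL, hbad⟩ := hs.log_cons hB
  generalize hO : outcome κ B (B :: s.log) (s.elapsed + 1) = O at hcase hdec
  generalize hD : decoded κ (B :: s.log) = D at hcase
  constructor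
  · intro j hj
    simp only [State.stepWith, Finset.mem_sdiff, State.mem_present] at hj
    rcases hj.1 with h | h
    · have := hs.fresh j h
      omega
    · omega
  · intro j
    simp only [State.stepWith]
    split_ifs
    · exact updateProb_nonneg (hs.prob_nonneg j) _
    · exact le_rfl
  · intro j hj
    simp only [State.stepWith] at hj ⊢
    rw [if_neg hj]
  · cases hcase with
    | silent h0 he =>
      refine ⟨B :: s.log, by simp [State.stepWith, hdec, hO], ?_⟩
      rw [hL, he, h0]
      simpa [IsGood] using hbad
    | progress hg h =>
      exact ⟨L, by simpa [State.stepWith, hdec, hO] using hL, hbad⟩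
    | success hg h =>
      exact ⟨[], by simp [State.stepWith, hdec, hO], by simp⟩
    | jam hgt h =>
      exact ⟨L, by simpa [State.stepWith, hdec, hO] using hL, hbad⟩
    | overfull hgt h =>
      refine ⟨B :: s.log, by simp [State.stepWith, hdec, hO], ?_⟩
      intro G hG
      rw [hL, List.mem_append] at hG
      rcases hG with hG | hG
      · rw [List.eq_of_mem_replicate hG]
        rintro ⟨-, h'⟩
        omega
      · exact hbad G hG
  · intro he j hj
    have hOO : O = .ongoing := by
      by_contra hne
      cases O <;> simp_all [State.stepWith]
    subst hOO
    have hj' := hactive j hj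
    have hjm : j ∈ s.present A t \ D := by
      cases hcase <;> simp [State.mem_present, hj'.1]
    refine ⟨by simpa only [State.stepWith, hD] using hjm, ?_⟩
    simp only [State.stepWith, hD, hO]
    rw [if_pos hjm]
    exact hj'.2
  all_goals
    intro he
    have hOO : O = .ongoing := by
      by_contra hne
      cases O <;> simp_all [State.stepWith]
    subst hOO
    simp only [State.stepWith, hO]
    cases hcase with
    | progress hg h =>
      first
        | exact Finset.card_pos.1 hg.1
        | (intro h'; have := hg.2; omega)
    | jam hgt h =>
      first
        | exact Finset.card_pos.1 (by omega)
        | (intro h'; omega)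

/-! ### Backlog, contention and inactive packets -/

/-- The contention: the sum of the joining probabilities. -/
noncomputable def State.load (s : State) : ℝ := ∑ j ∈ s.system, s.prob j

open Classical in
/-- The number of inactive packets in the system. -/
noncomputable def State.inactive (s : State) : ℕ := (s.system.filter fun j => s.prob j = 0).card

lemma State.Inv.card_present {κ t : ℕ} {s : State} (hs : s.Inv κ t) (A : Adversary) :
    (s.present A t).card = s.system.card + A s.history := by
  rw [State.present, Finset.card_union_of_disjoint, Finset.card_image_of_injective,
    Finset.card_range]
  · intro a b h
    simpa using h
  · rw [Finset.disjoint_left]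
    intro j hj hj'
    have := hs.fresh j hj
    simp only [Finset.mem_image] at hj'
    obtain ⟨k, -, rfl⟩ := hj'
    simp at this

lemma State.Inv.sum_present {κ t : ℕ} {s : State} (hs : s.Inv κ t) (A : Adversary) :
    ∑ j ∈ s.present A t, s.prob j = s.load := by
  symm
  apply Finset.sum_subset Finset.subset_union_left
  intro j _ hj
  exact hs.prob_eq_zero j hj

open Classical in
lemma State.Inv.card_filter_present {κ t : ℕ} {s : State} (hs : s.Inv κ t) (A : Adversary) :
    ((s.present A t).filter fun j => s.prob j = 0).card = s.inactive + A s.history := by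
  have h1 := Finset.card_filter_add_card_filter_not (s := s.present A t)
    (p := fun j => s.prob j = 0)
  have h2 := Finset.card_filter_add_card_filter_not (s := s.system) (p := fun j => s.prob j = 0)
  have h3 : (s.present A t).filter (fun j => ¬ s.prob j = 0) =
      s.system.filter fun j => ¬ s.prob j = 0 := by
    ext j
    simp only [Finset.mem_filter, State.mem_present]
    constructor
    · rintro ⟨-, h⟩
      exact ⟨by_contra fun h' => h (hs.prob_eq_zero j h'), h⟩
    · rintro ⟨h, h'⟩
      exact ⟨.inl h, h'⟩
  rw [h3, hs.card_present A] at h1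
  unfold State.inactive
  omega

/-- If all active packets stay active and nothing is decoded, the numbers of packets follow the
arrivals. -/
lemma State.Inv.step_keep {κ t : ℕ} {s : State} (hs : s.Inv κ t) (A : Adversary)
    {B : Finset Packet} {r : ℝ} (hr : r ≠ 0) (hD : decoded κ (B :: s.log) = ∅)
    (hp : ∀ p, updateProb κ p (outcome κ B (B :: s.log) (s.elapsed + 1)) = p * r) :
    (s.stepWith κ A t B).system.card = s.system.card + A s.history ∧
    (s.stepWith κ A t B).load = s.load * r ∧
    (s.stepWith κ A t B).inactive = s.inactive + A s.history := by
  classical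
  have hsys : (s.stepWith κ A t B).system = s.present A t := by simp [State.stepWith, hD]
  have hprob : ∀ j ∈ s.present A t, (s.stepWith κ A t B).prob j = s.prob j * r := by
    intro j hj
    simp [State.stepWith, hD, hj, hp]
  refine ⟨by rw [hsys, hs.card_present], ?_, ?_⟩
  · rw [State.load, hsys, Finset.sum_congr rfl hprob, ← Finset.sum_mul, hs.sum_present]
  · rw [State.inactive, hsys, ← hs.card_filter_present]
    congr 1
    apply Finset.filter_congr
    intro j hj
    simp [hprob j hj, hr]

lemma State.Inv.step_silent {κ t : ℕ} (hκ : 2 ≤ κ) {s : State} (hs : s.Inv κ t) (A : Adversary)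
    {B : Finset Packet} (hD : decoded κ (B :: s.log) = ∅)
    (hO : outcome κ B (B :: s.log) (s.elapsed + 1) = .silent) :
    (s.stepWith κ A t B).system.card = s.system.card + A s.history ∧
    (s.stepWith κ A t B).load =
      s.load * (κ : ℝ) ^ (1 / 4 : ℝ) + (s.inactive + A s.history : ℕ) / √(κ : ℝ) ∧
    (s.stepWith κ A t B).inactive = 0 := by
  classical
  have hκ0 : (0 : ℝ) < κ := by positivity
  have hsys : (s.stepWith κ A t B).system = s.present A t := by simp [State.stepWith, hD]
  have hprob : ∀ j ∈ s.present A t, (s.stepWith κ A t B).prob j =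
      s.prob j * (κ : ℝ) ^ (1 / 4 : ℝ) + if s.prob j = 0 then 1 / √(κ : ℝ) else 0 := by
    intro j hj
    simp only [State.stepWith, hD, Finset.sdiff_empty, if_pos hj, hO, updateProb]
    split_ifs with h <;> simp [h]
  refine ⟨by rw [hsys, hs.card_present], ?_, ?_⟩
  · rw [State.load, hsys, Finset.sum_congr rfl hprob, Finset.sum_add_distrib, ← Finset.sum_mul,
      hs.sum_present, ← Finset.sum_filter, Finset.sum_const, hs.card_filter_present, nsmul_eq_mul,
      mul_one_div]
  · rw [State.inactive, hsys, Finset.card_eq_zero, Finset.filter_eq_empty_iff]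
    intro j hj
    rw [hprob j hj]
    split_ifs with h
    · rw [h]
      positivity
    · have : (κ : ℝ) ^ (1 / 4 : ℝ) ≠ 0 := by positivity
      simpa [h] using this

lemma State.Inv.step_success {κ t : ℕ} {s : State} (hs : s.Inv κ t) (A : Adversary)
    {B : Finset Packet} (hact : ∀ j ∈ B, j ∈ s.system ∧ s.prob j ≠ 0)
    (hD : decoded κ (B :: s.log) = B)
    (hO : outcome κ B (B :: s.log) (s.elapsed + 1) = .successful) :
    (s.stepWith κ A t B).system.card + B.card = s.system.card + A s.history ∧
    (s.stepWith κ A t B).load ≤ s.load ∧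
    (s.stepWith κ A t B).inactive = s.inactive + A s.history := by
  classical
  have hsys : (s.stepWith κ A t B).system = s.present A t \ B := by simp [State.stepWith, hD]
  have hsub : B ⊆ s.present A t := fun j hj => State.mem_present.2 (.inl (hact j hj).1)
  have hprob : ∀ j ∈ s.present A t \ B, (s.stepWith κ A t B).prob j = s.prob j := by
    intro j hj
    simp only [State.stepWith, hD, if_pos hj, hO, updateProb]
  refine ⟨by rw [hsys, Finset.card_sdiff_add_card_eq_card hsub, hs.card_present], ?_, ?_⟩
  · rw [State.load, hsys, Finset.sum_congr rfl hprob, ← hs.sum_present A]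
    exact Finset.sum_le_sum_of_subset_of_nonneg Finset.sdiff_subset
      fun j _ _ => hs.prob_nonneg j
  · rw [State.inactive, hsys, ← hs.card_filter_present]
    congr 1
    ext j
    simp only [Finset.mem_filter]
    constructor
    · rintro ⟨hj, h⟩
      rw [hprob j hj] at h
      exact ⟨(Finset.mem_sdiff.1 hj).1, h⟩
    · rintro ⟨hj, h⟩
      have hj' : j ∈ s.present A t \ B := Finset.mem_sdiff.2 ⟨hj, fun hB => (hact j hB).2 h⟩
      exact ⟨hj', by rwa [hprob j hj']⟩

/-! ### Numerical facts about the threshold -/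

/-- The factor `κ ^ (1 / 4)` by which joining probabilities change. -/
noncomputable def ratio (κ : ℕ) : ℝ := (κ : ℝ) ^ (1 / 4 : ℝ)

lemma ratio_pos {κ : ℕ} (hκ : 144 ≤ κ) : 0 < ratio κ := by
  have : (0 : ℝ) < κ := by positivity
  unfold ratio
  positivity

lemma ratio_pow_four (κ : ℕ) : ratio κ ^ 4 = κ := by
  rw [ratio, ← Real.rpow_natCast, ← Real.rpow_mul (Nat.cast_nonneg κ)]
  norm_num

lemma ratio_sq (κ : ℕ) : ratio κ ^ 2 = √(κ : ℝ) := by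
  rw [ratio, ← Real.rpow_natCast, ← Real.rpow_mul (Nat.cast_nonneg κ), Real.sqrt_eq_rpow]
  norm_num

lemma twelve_le_sqrt {κ : ℕ} (hκ : 144 ≤ κ) : 12 ≤ √(κ : ℝ) := by
  apply Real.le_sqrt_of_sq_le
  have : (144 : ℝ) ≤ κ := by exact_mod_cast hκ
  linarith

lemma three_le_ratio {κ : ℕ} (hκ : 144 ≤ κ) : 3 ≤ ratio κ := by
  have h1 := twelve_le_sqrt hκ
  have h2 := ratio_sq κ
  have h3 := ratio_pos hκ
  nlinarith

lemma log_ratio (κ : ℕ) : Real.log (κ : ℝ) = 4 * Real.log (ratio κ) := by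
  have h := Real.log_pow (ratio κ) 4
  rw [ratio_pow_four] at h
  exact_mod_cast h

lemma log_ratio_pos {κ : ℕ} (hκ : 144 ≤ κ) : 0 < Real.log (ratio κ) :=
  Real.log_pos (by linarith [three_le_ratio hκ])

lemma taylor_three_le_exp {y : ℝ} (hy : 0 ≤ y) : 1 + y + y ^ 2 / 2 + y ^ 3 / 6 ≤ Real.exp y := by
  have := Real.sum_le_exp_of_nonneg hy 4
  simp [Finset.sum_range_succ, Nat.factorial] at this
  linarith

/-- From `z = √κ ≥ 12` on, `exp (z / 2)` dominates `κ ln κ`. -/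
lemma sq_mul_log_le_exp {z : ℝ} (hz : 12 ≤ z) :
    (z ^ 2 + 2) * (2 * Real.log z) ≤ 2 * Real.exp (z / 2) := by
  -- in terms of `y = (z - 12) / 2` both sides are bounded by cubics, compared coefficientwise
  obtain ⟨y, hy, rfl⟩ : ∃ y : ℝ, 0 ≤ y ∧ z = 12 + 2 * y := ⟨(z - 12) / 2, by linarith, by ring⟩
  have hexp : 403 * (1 + y + y ^ 2 / 2 + y ^ 3 / 6) ≤ Real.exp ((12 + 2 * y) / 2) := by
    have h6 : (403 : ℝ) ≤ Real.exp 6 := by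
      have h := Real.exp_one_gt_d9.le
      calc (403 : ℝ) ≤ 2.7182818283 ^ 6 := by norm_num
        _ ≤ Real.exp 1 ^ 6 := by gcongr
        _ = Real.exp 6 := by rw [← Real.exp_nat_mul]; norm_num
    rw [show (12 + 2 * y) / 2 = 6 + y by ring, Real.exp_add]
    exact mul_le_mul h6 (taylor_three_le_exp hy) (by positivity) (by positivity)
  have hlog : Real.log (12 + 2 * y) ≤ 2.5 + y / 6 := by
    have h12 : Real.log 12 ≤ 2.5 := by
      rw [Real.log_le_iff_le_exp (by norm_num)]
      have h := Real.exp_one_gt_d9.le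
      have h5 : (12 : ℝ) ^ 2 ≤ Real.exp 2.5 ^ 2 := by
        calc (12 : ℝ) ^ 2 ≤ 2.7182818283 ^ 5 := by norm_num
          _ ≤ Real.exp 1 ^ 5 := by gcongr
          _ = Real.exp 2.5 ^ 2 := by rw [← Real.exp_nat_mul, ← Real.exp_nat_mul]; norm_num
      exact le_of_sq_le_sq h5 (by positivity)
    have : Real.log (12 + 2 * y) = Real.log 12 + Real.log (1 + y / 6) := by
      rw [← Real.log_mul (by norm_num) (by positivity)]
      ring_nf
    rw [this]
    have := Real.log_le_sub_one_of_pos (show 0 < 1 + y / 6 by positivity)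
    linarith
  have h0 : 0 ≤ (12 + 2 * y) ^ 2 + 2 := by positivity
  have := mul_le_mul_of_nonneg_left hlog h0
  nlinarith [pow_nonneg hy 2, pow_nonneg hy 3]

/-- The exponential rate of the tail bounds, such that a loss of `κ + 2` slots amounts to a factor
`exp (1 / 2)`. -/
noncomputable def tailRate (κ : ℕ) : ℝ := 1 / (2 * (κ + 2))

lemma tailRate_pos (κ : ℕ) : 0 < tailRate κ := by
  unfold tailRate
  positivity

lemma exp_half_sub_one_le : Real.exp (1 / 2) - 1 ≤ 0.65 := by
  have h : Real.exp (1 / 2) ^ 2 ≤ 1.65 ^ 2 := by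
    rw [← Real.exp_nat_mul]
    have := Real.exp_one_lt_d9.le
    norm_num
    linarith
  have := le_of_sq_le_sq h (by norm_num)
  linarith

/-- The two atypical courses of the first slot of an epoch, silence in spite of contention above
`√κ / 2` and more than `κ` joining packets in spite of contention below `κ / 2`, are so
unlikely that a loss of `κ + 2` slots for each of them is compensated by an average gain
of `3 / ln κ` per slot. -/
lemma atypical_le {κ : ℕ} (hκ : 144 ≤ κ) :
    1 + (Real.exp (1 / 2) - 1) *
        (Real.exp (-(√(κ : ℝ) / 2)) + Real.exp ((κ : ℝ) / 2) * 2⁻¹ ^ κ) ≤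
      Real.exp (tailRate κ * (3 / Real.log κ)) := by
  set z := √(κ : ℝ) with hz
  have hz12 : 12 ≤ z := twelve_le_sqrt hκ
  have hzsq : z ^ 2 = κ := Real.sq_sqrt (Nat.cast_nonneg κ)
  have hlogz : Real.log κ = 2 * Real.log z := by
    rw [← hzsq, Real.log_pow]
    norm_num
  have hlog : 0 < Real.log z := Real.log_pos (by linarith)
  have h1 : Real.exp (-(z / 2)) ≤ 2 / ((κ + 2) * Real.log κ) := by
    rw [Real.exp_neg, hlogz, ← hzsq, inv_eq_one_div,
      div_le_div_iff₀ (by positivity) (by positivity)]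
    linarith [sq_mul_log_le_exp hz12]
  have h2 : Real.exp ((κ : ℝ) / 2) * 2⁻¹ ^ κ ≤ 0.1 * Real.exp (-(z / 2)) := by
    have e1 : (2⁻¹ : ℝ) ^ κ = Real.exp (-(Real.log 2 * κ)) := by
      rw [mul_comm, ← mul_neg, Real.exp_nat_mul, Real.exp_neg, Real.exp_log (by norm_num)]
    have e2 : Real.exp (-3) ≤ 0.1 := by
      rw [Real.exp_neg, inv_le_comm₀ (by positivity) (by norm_num)]
      have h := Real.exp_one_gt_d9.le
      calc (0.1 : ℝ)⁻¹ ≤ 2.7182818283 ^ 3 := by norm_num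
        _ ≤ Real.exp 1 ^ 3 := by gcongr
        _ = Real.exp 3 := by rw [← Real.exp_nat_mul]; norm_num
    calc _ = Real.exp ((κ : ℝ) / 2 - Real.log 2 * κ) := by
          rw [e1, ← Real.exp_add, sub_eq_add_neg]
      _ ≤ Real.exp (-3 + -(z / 2)) := by
          apply Real.exp_le_exp.2
          have := Real.log_two_gt_d9
          rw [← hzsq]
          nlinarith
      _ ≤ _ := by
          rw [Real.exp_add]
          gcongr
  have h3 : tailRate κ * (3 / Real.log κ) = 3 / 2 * (1 / ((κ + 2) * Real.log κ)) := by
    unfold tailRate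
    rw [hlogz]
    field_simp
  have h4 := Real.add_one_le_exp (tailRate κ * (3 / Real.log κ))
  have h5 : (0 : ℝ) ≤ 1 / ((κ + 2) * Real.log κ) := by rw [hlogz]; positivity
  have h6 : Real.exp (-(z / 2)) ≤ 2 * (1 / ((κ + 2) * Real.log κ)) := by rwa [mul_one_div]
  have h7 := Real.exp_pos (-(z / 2))
  have h8 : 0 ≤ Real.exp ((κ : ℝ) / 2) * 2⁻¹ ^ κ := by positivity
  have h9 := mul_le_mul_of_nonneg_right exp_half_sub_one_le (add_nonneg h7.le h8)
  linarith

/-! ### The potential -/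

/-- The number of overfull epochs that a contention `x` calls for: each of them divides it by
`ratio κ`, until it is below `κ ^ (3 / 4) / 2`. -/
noncomputable def excess (κ : ℕ) (x : ℝ) : ℝ :=
  max 0 (Real.log (2 * x / ratio κ ^ 3) / Real.log (ratio κ))

lemma excess_nonneg (κ : ℕ) (x : ℝ) : 0 ≤ excess κ x := le_max_left _ _

lemma excess_mono {κ : ℕ} (hκ : 144 ≤ κ) {x y : ℝ} (hx : 0 ≤ x) (hxy : x ≤ y) :
    excess κ x ≤ excess κ y := by
  have hq := ratio_pos hκ
  have hl := log_ratio_pos hκ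
  rcases hx.eq_or_lt with rfl | hx
  · simp [excess]
  · unfold excess
    gcongr

lemma excess_eq_zero {κ : ℕ} (hκ : 144 ≤ κ) {x : ℝ} (hx : 0 ≤ x) (hx' : x ≤ ratio κ ^ 3 / 2) :
    excess κ x = 0 := by
  have hq := ratio_pos hκ
  have hl := log_ratio_pos hκ
  apply max_eq_left
  apply div_nonpos_of_nonpos_of_nonneg _ hl.le
  apply Real.log_nonpos (by positivity)
  rw [div_le_one (by positivity)]
  linarith

lemma excess_div_add_one {κ : ℕ} (hκ : 144 ≤ κ) {x : ℝ} (hx : ratio κ ^ 4 / 2 ≤ x) :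
    excess κ (x / ratio κ) + 1 ≤ excess κ x := by
  have hq := ratio_pos hκ
  have hl := log_ratio_pos hκ
  have hx0 : 0 < x := lt_of_lt_of_le (by positivity) hx
  have h1 : Real.log (2 * (x / ratio κ) / ratio κ ^ 3) =
      Real.log (2 * x / ratio κ ^ 3) - Real.log (ratio κ) := by
    rw [← Real.log_div (by positivity) (by positivity)]
    congr 1
    field_simp
  have h2 : Real.log (ratio κ) ≤ Real.log (2 * x / ratio κ ^ 3) := by
    apply Real.log_le_log hq
    rw [le_div_iff₀ (by positivity)]
    nlinarith
  have h3 : 1 ≤ Real.log (2 * x / ratio κ ^ 3) / Real.log (ratio κ) := by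
    rwa [le_div_iff₀ hl, one_mul]
  unfold excess
  rw [h1, sub_div, div_self hl.ne', max_eq_right (by linarith), max_eq_right (by linarith)]
  linarith

lemma log_add_le {u v : ℝ} (hu : 0 ≤ u) (hv : 0 ≤ v) :
    Real.log (u + v) ≤ max 0 (Real.log u) + v := by
  rcases (add_nonneg hu hv).eq_or_lt with h | h
  · rw [← h, Real.log_zero]
    positivity
  rcases le_or_gt u 1 with h1 | h1
  · have := Real.log_le_sub_one_of_pos h
    have := le_max_left 0 (Real.log u)
    linarith
  · have h2 : Real.log (u + v) = Real.log u + Real.log (1 + v / u) := by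
      rw [← Real.log_mul (by positivity) (by positivity)]
      congr 1
      field_simp
    have h3 := Real.log_le_sub_one_of_pos (show 0 < 1 + v / u by positivity)
    have h4 : v / u ≤ v := div_le_self hv h1.le
    have := le_max_right 0 (Real.log u)
    linarith

lemma excess_add_le {κ : ℕ} (hκ : 144 ≤ κ) {x b : ℝ} (hx : 0 ≤ x) (hb : 0 ≤ b) :
    excess κ (x + b) ≤ excess κ x + 2 * b / (ratio κ ^ 3 * Real.log (ratio κ)) := by
  have hq := ratio_pos hκ
  have hl := log_ratio_pos hκ
  have h := log_add_le (u := 2 * x / ratio κ ^ 3) (v := 2 * b / ratio κ ^ 3) (by positivity)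
    (by positivity)
  rw [← add_div, ← mul_add] at h
  have h0 := excess_nonneg κ x
  have hv : 0 ≤ 2 * b / (ratio κ ^ 3 * Real.log (ratio κ)) := by positivity
  have e : excess κ x = max 0 (Real.log (2 * x / ratio κ ^ 3)) / Real.log (ratio κ) := by
    rw [excess, ← max_div_div_right hl.le, zero_div]
  refine max_le (by linarith) ?_
  rw [div_le_iff₀ hl, e]
  calc _ ≤ _ := h
    _ = _ := by field_simp

lemma excess_mul_ratio_le {κ : ℕ} (hκ : 144 ≤ κ) {x : ℝ} (hx : 0 ≤ x) :
    excess κ (x * ratio κ) ≤ excess κ x + 1 := by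
  have hq := ratio_pos hκ
  have hl := log_ratio_pos hκ
  have h0 := excess_nonneg κ x
  rcases hx.eq_or_lt with rfl | hx
  · simp [excess]
  have h1 : Real.log (2 * (x * ratio κ) / ratio κ ^ 3) =
      Real.log (2 * x / ratio κ ^ 3) + Real.log (ratio κ) := by
    rw [← Real.log_mul (by positivity) (by positivity)]
    congr 1
    field_simp
  refine max_le (by linarith) ?_
  rw [h1, add_div, div_self hl.ne']
  have : Real.log (2 * x / ratio κ ^ 3) / Real.log (ratio κ) ≤ excess κ x := le_max_right _ _
  linarith

/-- The price per arriving packet that pays for the overfull epochs caused by its activation.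
The constant is slightly larger than the `8` that these epochs require, which leaves a surplus. -/
noncomputable def price (κ : ℕ) : ℝ := 9 / (ratio κ * Real.log κ)

lemma price_pos {κ : ℕ} (hκ : 144 ≤ κ) : 0 < price κ := by
  have := ratio_pos hκ
  have := log_ratio_pos hκ
  unfold price
  rw [log_ratio]
  positivity

/-- When `m` packets become active, the price that they have brought along pays for all
the overfull epochs that this causes, with a surplus. -/
lemma activation_le {κ : ℕ} (hκ : 144 ≤ κ) {x m : ℝ} (hx : 0 ≤ x) (hm : 0 ≤ m) :
    (κ + 1) * excess κ (x * ratio κ + m / √(κ : ℝ)) + m / (κ : ℝ) ^ 2 ≤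
      (κ + 1) * excess κ (x * ratio κ) + price κ * m := by
  have hq := ratio_pos hκ
  have hq3 := three_le_ratio hκ
  have hl := log_ratio_pos hκ
  have h := excess_add_le hκ (x := x * ratio κ) (b := m / √(κ : ℝ)) (by positivity) (by positivity)
  have hκ0 : (0 : ℝ) < κ + 1 := by positivity
  have h2 := mul_le_mul_of_nonneg_left h hκ0.le
  have h3 : (κ + 1) * (2 * (m / √(κ : ℝ)) / (ratio κ ^ 3 * Real.log (ratio κ))) + m / (κ : ℝ) ^ 2 ≤
      price κ * m := by
    rw [price, log_ratio, ← ratio_sq, ← ratio_pow_four κ]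
    set q := ratio κ
    set l := Real.log q
    have hlq : l ≤ q := by
      have := Real.log_le_sub_one_of_pos hq
      linarith
    have key : (q ^ 4 + 1) * 2 / (q ^ 5 * l) + 1 / q ^ 8 ≤ 9 / (4 * (q * l)) := by
      have e1 : (q ^ 4 + 1) * 2 / (q ^ 5 * l) = (2 + 2 / q ^ 4) * (1 / (q * l)) := by field_simp
      have e2 : 1 / q ^ 8 ≤ 1 / q ^ 6 * (1 / (q * l)) := by
        rw [div_mul_div_comm, one_mul]
        apply one_div_le_one_div_of_le (by positivity)
        calc q ^ 6 * (q * l) ≤ q ^ 6 * (q * q) := by gcongr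
          _ = q ^ 8 := by ring
      have e3 : 2 / q ^ 4 ≤ 2 / 3 ^ 4 := by gcongr
      have e4 : 1 / q ^ 6 ≤ 1 / 3 ^ 6 := by gcongr
      have e5 : 9 / (4 * (q * l)) = 9 / 4 * (1 / (q * l)) := by field_simp
      rw [e1, e5]
      have e6 : (2 + 2 / q ^ 4 + 1 / q ^ 6) * (1 / (q * l)) ≤ 9 / 4 * (1 / (q * l)) := by
        gcongr
        linarith
      linarith
    calc _ = ((q ^ 4 + 1) * 2 / (q ^ 5 * l) + 1 / q ^ 8) * m := by field_simp
      _ ≤ 9 / (4 * (q * l)) * m := by gcongr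
      _ = _ := by ring
  linarith

/-- The future cost of the contention and of the current epoch. Between two epochs it is `κ + 1`
per overfull epoch that the contention calls for. Once the packets of an epoch have joined, its
outcome is determined, and the cost anticipates it: of a successful epoch each slot
counts as the delivery of one packet, while the loss of the rest of an overfull epoch, and the
decrease of the contention that it brings about, are booked at its beginning. -/
noncomputable def State.epochCost (κ : ℕ) (s : State) : ℝ :=
  if s.elapsed = 0 then (κ + 1) * excess κ s.load
  else if s.joined.card ≤ κ then (κ + 1) * excess κ s.load - s.elapsed
  else (κ + 1) * excess κ (s.load / ratio κ) + (κ + 1 - s.elapsed)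

/-- The potential of a state: the number of packets in the system, the price that the inactive
ones among them have brought along, and the cost of the contention. -/
noncomputable def State.potential (κ : ℕ) (s : State) : ℝ :=
  s.system.card + price κ * s.inactive + s.epochCost κ

/-- The change that an outcome makes to the number of silent minus the number of overfull
epochs. -/
def Outcome.drift : Outcome → ℤ
  | .ongoing => 0
  | .silent => 1
  | .successful => 0
  | .overfull => -1

/-- The atypical courses of the first slot of an epoch: silence in spite of high contention, or
too many joining packets in spite of moderate contention. -/
def State.Atypical (κ : ℕ) (s : State) (B : Finset Packet) : Prop :=
  s.elapsed = 0 ∧ ((B = ∅ ∧ √(κ : ℝ) / 2 < s.load) ∨ (κ < B.card ∧ s.load < (κ : ℝ) / 2))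

open Classical in
/-- The loss in an atypical slot. -/
noncomputable def State.loss (κ : ℕ) (s : State) (B : Finset Packet) : ℝ :=
  if s.Atypical κ B then κ + 2 else 0

lemma State.loss_nonneg (κ : ℕ) (s : State) (B : Finset Packet) : 0 ≤ s.loss κ B := by
  unfold State.loss
  split_ifs <;> positivity

lemma State.Inv.load_nonneg {κ t : ℕ} {s : State} (hs : s.Inv κ t) : 0 ≤ s.load :=
  Finset.sum_nonneg fun j _ => hs.prob_nonneg j

lemma State.epochCost_of_elapsed_eq_zero {κ : ℕ} {s : State} (h : s.elapsed = 0) :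
    s.epochCost κ = (κ + 1) * excess κ s.load := if_pos h

/-- A silent slot raises the contention, but while the contention was low, the price of the packets
it activates pays for that. -/
lemma State.Inv.potential_silent {κ t : ℕ} (hκ : 144 ≤ κ) {s : State} (hs : s.Inv κ t)
    (A : Adversary) {B : Finset Packet} (hB0 : B = ∅) (he : s.elapsed = 0)
    (hD : decoded κ (B :: s.log) = ∅)
    (hO : outcome κ B (B :: s.log) (s.elapsed + 1) = .silent) :
    (s.stepWith κ A t B).potential κ + (s.inactive + A s.history : ℕ) / (κ : ℝ) ^ 2 ≤
      s.potential κ + (1 + price κ) * A s.history + max 0 (s.loss κ B - 1) := by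
  obtain ⟨h1, h2, h3⟩ := hs.step_silent (by omega) A hD hO
  have hx := hs.load_nonneg
  have hq := ratio_pos hκ
  have he' : (s.stepWith κ A t B).elapsed = 0 := by simp [State.stepWith, hO]
  rw [State.potential, State.potential, State.epochCost_of_elapsed_eq_zero he,
    State.epochCost_of_elapsed_eq_zero he', h1, h2, h3]
  have hact := activation_le hκ hx (m := (s.inactive + A s.history : ℕ)) (Nat.cast_nonneg _)
  rw [show (κ : ℝ) ^ (1 / 4 : ℝ) = ratio κ from rfl]
  have hloss : (κ + 1) * excess κ (s.load * ratio κ) ≤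
      (κ + 1) * excess κ s.load + max 0 (s.loss κ B - 1) := by
    rcases le_or_gt s.load (√(κ : ℝ) / 2) with h | h
    -- up to this threshold, one silent slot does not yet lift the contention to where it costs
    · have : excess κ (s.load * ratio κ) = 0 := by
        apply excess_eq_zero hκ (by positivity)
        rw [← ratio_sq] at h
        calc s.load * ratio κ ≤ ratio κ ^ 2 / 2 * ratio κ := by gcongr
          _ = ratio κ ^ 3 / 2 := by ring
      rw [this]
      have := excess_nonneg κ s.load
      have := le_max_left 0 (s.loss κ B - 1)
      simp only [mul_zero]
      positivity
    · have hl : s.loss κ B = κ + 2 := if_pos ⟨he, .inl ⟨hB0, h⟩⟩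
      have h4 := excess_mul_ratio_le hκ hx
      have h5 : (κ : ℝ) + 1 ≤ max 0 (s.loss κ B - 1) := by
        rw [hl]
        exact le_max_of_le_right (by linarith)
      have h6 : (0 : ℝ) ≤ κ + 1 := by positivity
      nlinarith
  push_cast at hact ⊢
  linarith

/-- In every slot the potential, corrected for the drift of the joining probabilities and for the
arrivals, decreases by one, unless the slot is atypical. -/
lemma State.Inv.potential_step {κ t : ℕ} (hκ : 144 ≤ κ) {s : State} (hs : s.Inv κ t)
    (A : Adversary) {B : Finset Packet} (hB : s.Legal B) :
    (s.stepWith κ A t B).potential κ ≤ s.potential κ + (1 + price κ) * A s.history +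
      (outcome κ B (B :: s.log) (s.elapsed + 1)).drift - 1 + s.loss κ B := by
  classical
  obtain ⟨hcase, -⟩ := hs.slotCase (by omega) hB
  have hact : ∀ j ∈ B, j ∈ s.system ∧ s.prob j ≠ 0 := by
    rcases Nat.eq_zero_or_pos s.elapsed with he | he
    · exact hB.active he
    · rw [hB.joined he]
      exact hs.joined_active he
  have hx := hs.load_nonneg
  have hq := ratio_pos hκ
  have hloss := s.loss_nonneg κ B
  have hκ1 : (0 : ℝ) ≤ κ + 1 := by positivity
  have hpr := price_pos hκ
  have hcard : 0 < s.elapsed → s.joined.card = B.card := fun h => by rw [hB.joined h]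
  generalize hO : outcome κ B (B :: s.log) (s.elapsed + 1) = O at hcase
  generalize hD : decoded κ (B :: s.log) = D at hcase
  cases hcase with
  | silent h0 he =>
    have h := hs.potential_silent hκ A h0 he hD hO
    have h1 : max 0 (s.loss κ B - 1) ≤ s.loss κ B := max_le hloss (by linarith)
    have h2 : (0 : ℝ) ≤ (s.inactive + A s.history : ℕ) / (κ : ℝ) ^ 2 := by positivity
    simp only [Outcome.drift]
    push_cast at h h2 ⊢
    linarith
  | progress hg h =>
    obtain ⟨h1, h2, h3⟩ := hs.step_keep A one_ne_zero hD (by intro p; rw [hO, mul_one]; rfl)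
    have he' : (s.stepWith κ A t B).elapsed = s.elapsed + 1 := by simp [State.stepWith, hO]
    have hj : (s.stepWith κ A t B).joined = B := rfl
    simp only [State.potential, State.epochCost, h1, h2, h3, he', hj, if_pos hg.2, mul_one,
      Nat.succ_ne_zero, if_false, Outcome.drift]
    split_ifs with h4 h5
    · rw [h4]; push_cast; linarith
    · push_cast; linarith
    · rw [hcard (by omega)] at h5
      exact absurd hg.2 h5
  | success hg h =>
    obtain ⟨h1, h2, h3⟩ := hs.step_success A hact hD hO
    have h1' : ((s.stepWith κ A t B).system.card : ℝ) + B.card = s.system.card + A s.history := by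
      exact_mod_cast h1
    have he' : (s.stepWith κ A t B).elapsed = 0 := by simp [State.stepWith, hO]
    have hx' : 0 ≤ (s.stepWith κ A t B).load := (hs.stepWith (by omega) A hB).load_nonneg
    have hm := mul_le_mul_of_nonneg_left (excess_mono hκ hx' h2) hκ1
    rw [State.potential, State.potential, State.epochCost_of_elapsed_eq_zero he', h3,
      State.epochCost]
    have hc : (B.card : ℝ) = s.elapsed + 1 := by exact_mod_cast h.symm
    simp only [Outcome.drift]
    split_ifs with h4 h5
    · rw [h4] at hc; push_cast at hc ⊢; linarith
    · push_cast; linarith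
    · rw [hcard (by omega)] at h5
      exact absurd hg.2 h5
  | jam hgt h =>
    obtain ⟨h1, h2, h3⟩ := hs.step_keep A one_ne_zero hD (by intro p; rw [hO, mul_one]; rfl)
    have he' : (s.stepWith κ A t B).elapsed = s.elapsed + 1 := by simp [State.stepWith, hO]
    have hj : (s.stepWith κ A t B).joined = B := rfl
    simp only [State.potential, State.epochCost, h1, h2, h3, he', hj, if_neg hgt.not_ge, mul_one,
      Nat.succ_ne_zero, if_false, Outcome.drift]
    split_ifs with h4 h5
    -- the loss of the whole epoch is booked in its first slot, and so is the relief it brings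
    · have hkey : (κ + 1) * excess κ (s.load / ratio κ) + (κ + 1) ≤
          (κ + 1) * excess κ s.load + s.loss κ B := by
        rcases lt_or_ge s.load ((κ : ℝ) / 2) with h5 | h5
        · have hl : s.loss κ B = κ + 2 := if_pos ⟨h4, .inr ⟨hgt, h5⟩⟩
          have hle : s.load / ratio κ ≤ s.load :=
            div_le_self hx (by linarith [three_le_ratio hκ])
          have := mul_le_mul_of_nonneg_left (excess_mono hκ (by positivity) hle) hκ1
          linarith
        · rw [← ratio_pow_four κ] at h5
          have := mul_le_mul_of_nonneg_left (excess_div_add_one hκ h5) hκ1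
          linarith
      rw [h4]; push_cast; linarith
    · rw [hcard (by omega)] at h5
      omega
    · push_cast; linarith
  | overfull hgt h =>
    obtain ⟨h1, h2, h3⟩ := hs.step_keep A (inv_ne_zero hq.ne') hD
      (by intro p; rw [hO, ← div_eq_mul_inv]; rfl)
    have he' : (s.stepWith κ A t B).elapsed = 0 := by simp [State.stepWith, hO]
    have he0 : s.elapsed ≠ 0 := by omega
    have hc : (κ : ℝ) = s.elapsed + 1 := by exact_mod_cast h.symm
    rw [State.potential, State.potential, State.epochCost_of_elapsed_eq_zero he', h1, h2, h3,
      State.epochCost, if_neg he0, if_neg (by rw [hcard (by omega)]; exact hgt.not_ge),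
      ← div_eq_mul_inv]
    simp only [Outcome.drift]
    push_cast
    linarith

/-- If there are many packets and none of the active ones has a joining probability below
`1 / √κ`, then a silent slot decreases the potential by one even without the correction for
the drift, unless it is atypical: almost all of the packets are inactive and have brought along a
large price. -/
lemma State.Inv.potential_step_of_prob_ge {κ t : ℕ} (hκ : 144 ≤ κ) {s : State} (hs : s.Inv κ t)
    (A : Adversary) {B : Finset Packet} (hB : s.Legal B) (hB0 : B = ∅)
    (hp : ∀ j ∈ s.system, s.prob j ≠ 0 → 1 / √(κ : ℝ) ≤ s.prob j)
    (hR : 4 * (κ : ℝ) ^ 2 ≤ s.system.card) :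
    (s.stepWith κ A t B).potential κ ≤ s.potential κ + (1 + price κ) * A s.history - 1 +
      s.loss κ B := by
  classical
  obtain ⟨hcase, -⟩ := hs.slotCase (by omega) hB
  have hx := hs.load_nonneg
  have hκ1 : (144 : ℝ) ≤ κ := by exact_mod_cast hκ
  generalize hO : outcome κ B (B :: s.log) (s.elapsed + 1) = O at hcase
  generalize hD : decoded κ (B :: s.log) = D at hcase
  cases hcase with
  | silent h0 he =>
    have h := hs.potential_silent hκ A h0 he hD hO
    rcases le_or_gt s.load (√(κ : ℝ) / 2) with hlow | hhigh
    -- at most `κ / 2` packets are active, as each contributes `1 / √κ` to the contention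
    · have hl : s.loss κ B = 0 := by
        apply if_neg
        rintro ⟨-, ⟨-, h'⟩ | ⟨h', -⟩⟩
        · linarith
        · simp [hB0] at h'
      have hact : ((s.system.filter fun j => ¬ s.prob j = 0).card : ℝ) / √(κ : ℝ) ≤ s.load := by
        calc _ = ∑ j ∈ s.system.filter (fun j => ¬ s.prob j = 0), 1 / √(κ : ℝ) := by
              rw [Finset.sum_const, nsmul_eq_mul, mul_one_div]
          _ ≤ ∑ j ∈ s.system.filter (fun j => ¬ s.prob j = 0), s.prob j := by
              apply Finset.sum_le_sum
              intro j hj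
              rw [Finset.mem_filter] at hj
              exact hp j hj.1 hj.2
          _ ≤ s.load := Finset.sum_le_sum_of_subset_of_nonneg (Finset.filter_subset _ _)
              fun j _ _ => hs.prob_nonneg j
      have hsq := twelve_le_sqrt hκ
      have hact' : ((s.system.filter fun j => ¬ s.prob j = 0).card : ℝ) ≤ κ / 2 := by
        rw [div_le_iff₀ (by positivity)] at hact
        have : s.load * √(κ : ℝ) ≤ √(κ : ℝ) / 2 * √(κ : ℝ) := by gcongr
        have hs := Real.mul_self_sqrt (Nat.cast_nonneg (α := ℝ) κ)
        linarith
      have hsum : (s.inactive : ℝ) + (s.system.filter fun j => ¬ s.prob j = 0).card =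
          s.system.card := by
        exact_mod_cast Finset.card_filter_add_card_filter_not (s := s.system)
          (p := fun j => s.prob j = 0)
      have h1 : (1 : ℝ) ≤ (s.inactive + A s.history : ℕ) / (κ : ℝ) ^ 2 := by
        rw [one_le_div (by positivity)]
        push_cast
        have : (0 : ℝ) ≤ A s.history := Nat.cast_nonneg _
        nlinarith
      rw [hl] at h ⊢
      rw [show max (0 : ℝ) (0 - 1) = 0 by norm_num] at h
      linarith
    · have hl : s.loss κ B = κ + 2 := if_pos ⟨he, .inl ⟨hB0, hhigh⟩⟩
      have h2 : (0 : ℝ) ≤ (s.inactive + A s.history : ℕ) / (κ : ℝ) ^ 2 := by positivity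
      rw [hl] at h ⊢
      rw [max_eq_right (by linarith)] at h
      linarith
  | progress hg h => simp [hB0] at h
  | success hg h => simp [hB0] at h
  | jam hgt h => simp [hB0] at hgt
  | overfull hgt h => simp [hB0] at hgt

/-! ### Counters along a history -/

/-- The histories that are possible under some coins. -/
def LegalHistory (κ : ℕ) (A : Adversary) : List (Finset Packet) → Prop
  | [] => True
  | B :: h => LegalHistory κ A h ∧ (replay κ A h).Legal B

lemma LegalHistory.inv {κ : ℕ} (hκ : 2 ≤ κ) {A : Adversary} {h : List (Finset Packet)}
    (hh : LegalHistory κ A h) : (replay κ A h).Inv κ h.length := by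
  induction h with
  | nil => constructor <;> simp [replay, State.init]
  | cons B h ih => exact (ih hh.1).stepWith hκ A hh.2

/-- The outcome of a slot with broadcasters `B` after the history `h`. -/
noncomputable def outcomeAfter (κ : ℕ) (A : Adversary) (h : List (Finset Packet))
    (B : Finset Packet) : Outcome :=
  outcome κ B (B :: (replay κ A h).log) ((replay κ A h).elapsed + 1)

/-- The number of silent minus the number of overfull epochs. -/
noncomputable def netDrift (κ : ℕ) (A : Adversary) : List (Finset Packet) → ℤ
  | [] => 0
  | B :: h => netDrift κ A h + (outcomeAfter κ A h B).drift

/-- An upper bound on the depths of the active packets, where a packet with joining probability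
`κ ^ (- d / 4)` has depth `d`. It follows the drift of the joining probabilities, but stays at
least `2`, the depth at which packets become active. -/
noncomputable def depth (κ : ℕ) (A : Adversary) : List (Finset Packet) → ℤ
  | [] => 2
  | B :: h => max (depth κ A h - (outcomeAfter κ A h B).drift) 2

/-- The system is idle if all joining probabilities are large, and yet there are at most `w / 4`
packets. -/
def Idle (κ w : ℕ) (A : Adversary) (h : List (Finset Packet)) : Prop :=
  depth κ A h = 2 ∧ 4 * (replay κ A h).system.card ≤ w

open Classical in
/-- The number of silent slots in which the system was idle. -/
noncomputable def idleCount (κ w : ℕ) (A : Adversary) : List (Finset Packet) → ℕ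
  | [] => 0
  | B :: h => idleCount κ w A h + if B = ∅ ∧ Idle κ w A h then 1 else 0

/-- The number of packets injected so far. -/
def injected (A : Adversary) : List (Finset Packet) → ℕ
  | [] => 0
  | _ :: h => injected A h + A h

lemma two_le_depth (κ : ℕ) (A : Adversary) (h : List (Finset Packet)) : 2 ≤ depth κ A h := by
  cases h with
  | nil => exact le_rfl
  | cons B h => exact le_max_right _ _

lemma outcomeAfter_empty (κ : ℕ) (A : Adversary) (h : List (Finset Packet)) :
    outcomeAfter κ A h ∅ = .silent := by
  simp [outcomeAfter, outcome]

lemma drift_le_zero {κ : ℕ} {A : Adversary} {h : List (Finset Packet)} {B : Finset Packet}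
    (hB : B ≠ ∅) : (outcomeAfter κ A h B).drift ≤ 0 := by
  unfold outcomeAfter outcome
  rw [if_neg hB]
  split_ifs <;> simp [Outcome.drift]

/-- The joining probability of an active packet changes by one factor `ratio κ` per unit of
drift. -/
lemma updateProb_of_ne_zero {κ : ℕ} {p : ℝ} (hp : p ≠ 0) (o : Outcome) :
    updateProb κ p o = p * ratio κ ^ o.drift := by
  cases o <;> simp [updateProb, Outcome.drift, hp, ratio, div_eq_mul_inv]

lemma ratio_zpow_neg_two (κ : ℕ) : ratio κ ^ (-2 : ℤ) = 1 / √(κ : ℝ) := by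
  rw [zpow_neg, ← ratio_sq, one_div]
  norm_cast

/-- A packet that becomes active has heard a silent slot, and starts at depth `2`. -/
lemma updateProb_zero {κ : ℕ} {o : Outcome} (h : updateProb κ 0 o ≠ 0) :
    o = .silent ∧ updateProb κ 0 o = ratio κ ^ (-2 : ℤ) := by
  rw [ratio_zpow_neg_two]
  cases o <;> simp_all [updateProb]

lemma LegalHistory.zpow_neg_depth_le {κ : ℕ} (hκ : 144 ≤ κ) {A : Adversary}
    {h : List (Finset Packet)} (hh : LegalHistory κ A h) :
    ∀ j ∈ (replay κ A h).system, (replay κ A h).prob j ≠ 0 →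
      ratio κ ^ (-depth κ A h) ≤ (replay κ A h).prob j := by
  classical
  have hq := ratio_pos hκ
  have hq1 : 1 ≤ ratio κ := by linarith [three_le_ratio hκ]
  induction h with
  | nil => simp [replay, State.init]
  | cons B h ih =>
    intro j hj hne
    have hj' : j ∈ (replay κ A h).present A h.length \ decoded κ (B :: (replay κ A h).log) := hj
    have hprob : (replay κ A (B :: h)).prob j =
        updateProb κ ((replay κ A h).prob j) (outcomeAfter κ A h B) := if_pos hj'
    rw [hprob] at hne ⊢
    by_cases h0 : (replay κ A h).prob j = 0
    · rw [h0] at hne ⊢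
      rw [(updateProb_zero hne).2]
      exact zpow_le_zpow_right₀ hq1 (by have := two_le_depth κ A (B :: h); omega)
    · have hsys : j ∈ (replay κ A h).system := by
        by_contra hns
        exact h0 ((hh.1.inv (by omega)).prob_eq_zero j hns)
      rw [updateProb_of_ne_zero h0]
      calc ratio κ ^ (-depth κ A (B :: h))
          ≤ ratio κ ^ (-depth κ A h + (outcomeAfter κ A h B).drift) := by
            apply zpow_le_zpow_right₀ hq1
            have : depth κ A h - (outcomeAfter κ A h B).drift ≤ depth κ A (B :: h) :=
              le_max_left _ _
            omega
        _ = ratio κ ^ (-depth κ A h) * ratio κ ^ (outcomeAfter κ A h B).drift :=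
            zpow_add₀ hq.ne' _ _
        _ ≤ _ := by
            gcongr
            exact ih hh.1 j hsys h0

/-- The quantity with an exponentially bounded upper tail: the potential and the depth, which
decrease by one per slot except in idle silent slots, each arrival, and atypical slots. A gain of
`3 / ln κ` per slot is set aside for the atypical slots. -/
noncomputable def balance (κ w : ℕ) (A : Adversary) (h : List (Finset Packet)) : ℝ :=
  (replay κ A h).potential κ + depth κ A h - idleCount κ w A h +
    (1 - 3 / Real.log κ) * h.length - (1 + price κ) * injected A h

lemma LegalHistory.balance_cons_le {κ w : ℕ} (hκ : 144 ≤ κ) (hw : 16 * κ ^ 2 ≤ w) {A : Adversary}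
    {h : List (Finset Packet)} {B : Finset Packet} (hh : LegalHistory κ A (B :: h)) :
    balance κ w A (B :: h) ≤
      balance κ w A h - 3 / Real.log κ + (replay κ A h).loss κ B := by
  have hI := hh.1.inv (by omega : 2 ≤ κ)
  have hstep := hI.potential_step hκ A hh.2
  rw [replay_history, show outcome κ B (B :: (replay κ A h).log) ((replay κ A h).elapsed + 1) =
    outcomeAfter κ A h B from rfl] at hstep
  have hD2 := two_le_depth κ A h
  suffices hmain : (replay κ A (B :: h)).potential κ + depth κ A (B :: h) -
      idleCount κ w A (B :: h) ≤ (replay κ A h).potential κ + depth κ A h - idleCount κ w A h - 1 +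
        (1 + price κ) * A h + (replay κ A h).loss κ B by
    have e : ((B :: h).length : ℝ) = h.length + 1 := by simp
    have e' : (injected A (B :: h) : ℝ) = injected A h + A h := by simp [injected]
    unfold balance
    rw [e, e']
    linarith
  by_cases hcrit : B = ∅ ∧ depth κ A h = 2
  · obtain ⟨hB, hD⟩ := hcrit
    have hdrift : outcomeAfter κ A h B = .silent := by rw [hB, outcomeAfter_empty]
    have hD' : depth κ A (B :: h) = 2 := by
      simp [depth, hdrift, Outcome.drift, hD]
    rw [hD, hD']
    by_cases hidle : Idle κ w A h
    · have hU : idleCount κ w A (B :: h) = idleCount κ w A h + 1 := by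
        simp [idleCount, hB, hidle]
      rw [hdrift] at hstep
      rw [hU]
      simp only [Outcome.drift] at hstep
      push_cast at hstep ⊢
      change (replay κ A (B :: h)).potential κ ≤ _ at hstep
      linarith
    · have hU : idleCount κ w A (B :: h) = idleCount κ w A h := by
        simp [idleCount, hidle]
      have hR : 4 * (κ : ℝ) ^ 2 ≤ (replay κ A h).system.card := by
        have : w < 4 * (replay κ A h).system.card := by
          by_contra hcon
          exact hidle ⟨hD, by omega⟩
        have h2 : 4 * κ ^ 2 ≤ (replay κ A h).system.card := by omega
        exact_mod_cast h2
      have hp := hh.1.zpow_neg_depth_le hκ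
      rw [hD, ratio_zpow_neg_two] at hp
      have hstep' := hI.potential_step_of_prob_ge hκ A hh.2 hB hp hR
      rw [replay_history] at hstep'
      change (replay κ A (B :: h)).potential κ ≤ _ at hstep'
      rw [hU]
      linarith
  · have hU : idleCount κ w A (B :: h) = idleCount κ w A h := by
      have : ¬ (B = ∅ ∧ Idle κ w A h) := fun h' => hcrit ⟨h'.1, h'.2.1⟩
      simp [idleCount, this]
    have hD' : depth κ A (B :: h) = depth κ A h - (outcomeAfter κ A h B).drift := by
      apply max_eq_left
      by_cases hB : B = ∅
      · rw [hB, outcomeAfter_empty]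
        have : depth κ A h ≠ 2 := fun h' => hcrit ⟨hB, h'⟩
        simp only [Outcome.drift]
        omega
      · have := drift_le_zero (κ := κ) (A := A) (h := h) hB
        omega
    rw [hU, hD']
    push_cast
    change (replay κ A (B :: h)).potential κ ≤ _ at hstep
    linarith

/-- Idle silent slots drive the joining probabilities up. -/
lemma idleCount_cons_sub_le (κ w : ℕ) (A : Adversary) (h : List (Finset Packet))
    (B : Finset Packet) :
    (idleCount κ w A (B :: h) : ℤ) - depth κ A (B :: h) - netDrift κ A (B :: h) ≤
      idleCount κ w A h - depth κ A h - netDrift κ A h := by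
  have hD2 := two_le_depth κ A h
  have hD : depth κ A h - (outcomeAfter κ A h B).drift ≤ depth κ A (B :: h) := le_max_left _ _
  have hD' : 2 ≤ depth κ A (B :: h) := two_le_depth _ _ _
  simp only [netDrift, idleCount]
  split_ifs with hc
  · obtain ⟨rfl, hidle, -⟩ := hc
    rw [outcomeAfter_empty]
    simp only [Outcome.drift]
    push_cast
    omega
  · push_cast
    omega

/-! ### The coins of one slot -/

instance : IsProbabilityMeasure coinMeasure := by
  unfold coinMeasure
  infer_instance

/-- The events that depend only on the coins of the slots in `T`. -/
abbrev coinAlgebra (T : Set ℕ) : MeasurableSpace Coins :=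
  ⨆ i ∈ {i : ℕ × Packet | i.1 ∈ T}, MeasurableSpace.comap (fun ω : Coins => ω i) inferInstance

lemma coinAlgebra_le (T : Set ℕ) : coinAlgebra T ≤ (inferInstance : MeasurableSpace Coins) :=
  iSup₂_le fun i _ => (measurable_pi_apply i).comap_le

lemma coinAlgebra_mono {T T' : Set ℕ} (h : T ⊆ T') : coinAlgebra T ≤ coinAlgebra T' :=
  biSup_mono fun _ hi => h hi

lemma indep_coinAlgebra {T T' : Set ℕ} (h : Disjoint T T') :
    Indep (coinAlgebra T) (coinAlgebra T') coinMeasure := by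
  apply indep_iSup_of_disjoint
  · exact fun i => (measurable_pi_apply i).comap_le
  · exact (iIndepFun_infinitePi (P := fun _ : ℕ × Packet => (volume : Measure unitInterval))
      (X := fun _ x => x) fun _ => measurable_id).iIndep
  · rw [Set.disjoint_left] at h ⊢
    exact fun i hi hi' => h hi hi'

lemma measurable_coin {T : Set ℕ} {t : ℕ} (ht : t ∈ T) (j : Packet) :
    Measurable[coinAlgebra T] fun ω : Coins => ω (t, j) := by
  rw [measurable_iff_comap_le]
  exact le_iSup₂_of_le (t, j) ht le_rfl

lemma measurableSet_coin_lt {T : Set ℕ} {t : ℕ} (ht : t ∈ T) (j : Packet) (p : ℝ) :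
    MeasurableSet[coinAlgebra T] {ω : Coins | (ω (t, j) : ℝ) < p} :=
  measurable_coin ht j (measurableSet_lt measurable_subtype_coe measurable_const)

/-- The broadcasters in slot `t` from the state `s` depend only on the coins of slot `t`. -/
lemma measurableSet_broadcasters (s : State) (A : Adversary) (t : ℕ) (B : Finset Packet) :
    MeasurableSet[coinAlgebra {t}]
      {ω : Coins | s.broadcasters A t (fun j => ω (t, j)) = B} := by
  classical
  unfold State.broadcasters
  split_ifs
  · have h : ∀ j : Packet, MeasurableSet[coinAlgebra {t}]
        {ω : Coins | (j ∈ s.present A t ∧ (ω (t, j) : ℝ) < s.prob j) ↔ j ∈ B} := by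
      intro j
      have hj : MeasurableSet[coinAlgebra {t}] {ω : Coins | (ω (t, j) : ℝ) < s.prob j} :=
        measurableSet_coin_lt (Set.mem_singleton t) j _
      by_cases h1 : j ∈ s.present A t <;> by_cases h2 : j ∈ B
      · simpa [h1, h2] using hj
      · convert hj.compl using 1
        ext ω
        simp [h1, h2]
      · simp [h1, h2]
      · simp [h1, h2]
    have e : {ω : Coins | (s.present A t).filter (fun j => (ω (t, j) : ℝ) < s.prob j) = B} =
        ⋂ j : Packet, {ω : Coins | (j ∈ s.present A t ∧ (ω (t, j) : ℝ) < s.prob j) ↔ j ∈ B} := by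
      ext ω
      simp only [Set.mem_iInter, Set.mem_ofPred_eq, Finset.ext_iff, Finset.mem_filter]
    rw [e]
    exact MeasurableSet.iInter h
  · exact MeasurableSet.const _

lemma coinMeasure_forall_mem (t : ℕ) (S : Finset Packet) {E : Packet → Set unitInterval}
    (hE : ∀ j, MeasurableSet (E j)) :
    coinMeasure {ω | ∀ j ∈ S, ω (t, j) ∈ E j} = ∏ j ∈ S, volume (E j) := by
  have h := Measure.infinitePi_pi (μ := fun _ : ℕ × Packet => (volume : Measure unitInterval))
    (s := S.map (Function.Embedding.sectR t Packet)) (t := fun i => E i.2)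
    fun i _ => hE i.2
  rw [Finset.prod_map] at h
  have e : {ω : Coins | ∀ j ∈ S, ω (t, j) ∈ E j} = Set.pi
      ((S.map (Function.Embedding.sectR t Packet) : Finset (ℕ × Packet)) :
        Set (ℕ × Packet)) fun i => E i.2 := by
    ext ω
    simp only [Set.mem_ofPred_eq, Set.mem_pi, Finset.mem_coe, Finset.mem_map,
      Function.Embedding.sectR_apply, forall_exists_index, and_imp]
    exact ⟨fun H i j hj hi => hi ▸ H j hj, fun H j hj => H (t, j) j hj rfl⟩
  rw [e]
  exact h

lemma volume_lt_le {p : ℝ} (hp : 0 ≤ p) :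
    (volume : Measure unitInterval) {u | (u : ℝ) < p} ≤ ENNReal.ofReal p := by
  rcases le_or_gt p 1 with h | h
  · exact (unitInterval.volume_Iio (x := ⟨p, hp, h⟩)).le
  · exact prob_le_one.trans (by simpa using ENNReal.ofReal_le_ofReal h.le)

lemma volume_not_lt_le {p : ℝ} (hp : 0 ≤ p) :
    (volume : Measure unitInterval) {u | ¬ (u : ℝ) < p} ≤ ENNReal.ofReal (Real.exp (-p)) := by
  rcases le_or_gt p 1 with h | h
  · have e : {u : unitInterval | ¬ (u : ℝ) < p} = Set.Ici ⟨p, hp, h⟩ := by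
      ext u
      simp [← Subtype.coe_le_coe]
    rw [e, unitInterval.volume_Ici]
    apply ENNReal.ofReal_le_ofReal
    have := Real.add_one_le_exp (-p)
    simp only
    linarith
  · have e : {u : unitInterval | ¬ (u : ℝ) < p} = ∅ := by
      ext u
      have := u.2.2
      simp only [Set.mem_ofPred_eq, Set.mem_empty_iff_false, iff_false, not_not]
      linarith
    rw [e]
    simp

/-- The probability that an epoch is silent. -/
lemma State.Inv.measure_broadcasters_eq_empty_le {κ t : ℕ} {s : State} (hs : s.Inv κ t)
    (A : Adversary) (he : s.elapsed = 0) :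
    coinMeasure {ω | s.broadcasters A t (fun j => ω (t, j)) = ∅} ≤
      ENNReal.ofReal (Real.exp (-s.load)) := by
  classical
  have e : {ω : Coins | s.broadcasters A t (fun j => ω (t, j)) = ∅} =
      {ω : Coins | ∀ j ∈ s.present A t, ω (t, j) ∈ {u : unitInterval | ¬ (u : ℝ) < s.prob j}} := by
    ext ω
    simp only [Set.mem_ofPred_eq, State.broadcasters, if_pos he, Finset.filter_eq_empty_iff]
  rw [e, coinMeasure_forall_mem t (s.present A t)
    (E := fun j => {u : unitInterval | ¬ (u : ℝ) < s.prob j}) fun j =>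
      (measurableSet_lt measurable_subtype_coe measurable_const).compl]
  calc _ ≤ ∏ j ∈ s.present A t, ENNReal.ofReal (Real.exp (-s.prob j)) :=
        Finset.prod_le_prod' fun j _ => volume_not_lt_le (hs.prob_nonneg j)
    _ = _ := by
        rw [← ENNReal.ofReal_prod_of_nonneg fun _ _ => (Real.exp_pos _).le, ← Real.exp_sum,
          Finset.sum_neg_distrib, hs.sum_present]

/-- The probability that more than `κ` packets join an epoch, by Markov's inequality for the number
of sets of joining packets. -/
lemma State.Inv.measure_lt_card_broadcasters_le {κ t : ℕ} {s : State} (hs : s.Inv κ t)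
    (A : Adversary) (he : s.elapsed = 0) :
    coinMeasure {ω | κ < (s.broadcasters A t (fun j => ω (t, j))).card} ≤
      ENNReal.ofReal (Real.exp s.load * 2⁻¹ ^ κ) := by
  classical
  set P := s.present A t
  set b : Coins → Finset Packet := fun ω => s.broadcasters A t fun j => ω (t, j) with hb
  have hbf : ∀ ω, b ω = P.filter fun j => (ω (t, j) : ℝ) < s.prob j := fun ω => by
    simp only [hb, State.broadcasters, if_pos he, P]
  set E : Finset Packet → Set Coins := fun S =>
    {ω | ∀ j ∈ S, ω (t, j) ∈ {u : unitInterval | (u : ℝ) < s.prob j}} with hE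
  have hm : ∀ j, MeasurableSet {u : unitInterval | (u : ℝ) < s.prob j} := fun j =>
    measurableSet_lt measurable_subtype_coe measurable_const
  have hEm : ∀ S, MeasurableSet (E S) := fun S => by
    have : E S = ⋂ j ∈ S, {ω : Coins | (ω (t, j) : ℝ) < s.prob j} := by
      ext ω
      simp [hE]
    rw [this]
    exact Finset.measurableSet_biInter _ fun j _ =>
      coinAlgebra_le {t} _ (measurableSet_coin_lt (Set.mem_singleton t) j _)
  have hsum : ∀ ω, (2 : ℝ≥0∞) ^ (b ω).card = ∑ S ∈ P.powerset, (E S).indicator 1 ω := by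
    intro ω
    have h1 : P.powerset.filter (fun S => ω ∈ E S) = (b ω).powerset := by
      ext S
      simp only [Finset.mem_filter, Finset.mem_powerset, hE, Set.mem_ofPred_eq, hbf,
        Finset.subset_iff]
      exact ⟨fun h j hj => ⟨h.1 hj, h.2 j hj⟩,
        fun h => ⟨fun j hj => (h hj).1, fun j hj => (h hj).2⟩⟩
    simp only [Set.indicator_apply, Pi.one_apply]
    rw [← Finset.sum_filter, h1]
    simp
  have hint : ∫⁻ ω, 2 ^ (b ω).card ∂coinMeasure ≤ ENNReal.ofReal (Real.exp s.load) := by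
    calc ∫⁻ ω, 2 ^ (b ω).card ∂coinMeasure
        = ∑ S ∈ P.powerset, coinMeasure (E S) := by
          simp_rw [hsum]
          rw [lintegral_finsetSum _ fun S _ => measurable_one.indicator (hEm S)]
          simp_rw [lintegral_indicator_one (hEm _)]
      _ ≤ ∑ S ∈ P.powerset, ∏ j ∈ S, ENNReal.ofReal (s.prob j) := by
          apply Finset.sum_le_sum
          intro S _
          rw [hE, coinMeasure_forall_mem t S (E := fun j => {u : unitInterval | (u : ℝ) < s.prob j})
            hm]
          exact Finset.prod_le_prod' fun j _ => volume_lt_le (hs.prob_nonneg j)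
      _ = ∏ j ∈ P, (1 + ENNReal.ofReal (s.prob j)) := (Finset.prod_one_add _).symm
      _ ≤ ∏ j ∈ P, ENNReal.ofReal (Real.exp (s.prob j)) := by
          apply Finset.prod_le_prod'
          intro j _
          rw [← ENNReal.ofReal_one, ← ENNReal.ofReal_add zero_le_one (hs.prob_nonneg j), add_comm]
          exact ENNReal.ofReal_le_ofReal (Real.add_one_le_exp _)
      _ = _ := by
          rw [← ENNReal.ofReal_prod_of_nonneg fun _ _ => (Real.exp_pos _).le, ← Real.exp_sum,
            hs.sum_present]
  have hbm : Measurable fun ω => (2 : ℝ≥0∞) ^ (b ω).card := by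
    simp_rw [hsum]
    exact Finset.measurable_fun_sum _ fun S _ => measurable_one.indicator (hEm S)
  have hmarkov := (mul_meas_ge_le_lintegral (μ := coinMeasure) hbm (2 ^ κ)).trans hint
  have hsub : {ω | κ < (b ω).card} ⊆ {ω | (2 : ℝ≥0∞) ^ κ ≤ 2 ^ (b ω).card} := fun ω hω =>
    pow_le_pow_right₀ (by norm_num : (1 : ℝ≥0∞) ≤ 2) (hω : κ < (b ω).card).le
  refine (measure_mono hsub).trans ?_
  rw [ENNReal.ofReal_mul (Real.exp_pos _).le, ENNReal.ofReal_pow (by norm_num),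
    ENNReal.ofReal_inv_of_pos (by norm_num), ENNReal.ofReal_ofNat, ← ENNReal.inv_pow,
    ← div_eq_mul_inv, ENNReal.le_div_iff_mul_le (.inl (by simp)) (.inl (by simp)), mul_comm]
  exact hmarkov

/-! ### The law of the history -/

/-- The broadcast history before slot `t`. -/
noncomputable def hist (κ : ℕ) (A : Adversary) (ω : Coins) (t : ℕ) : List (Finset Packet) :=
  (run κ A ω t).history

/-- The broadcasters of the slot that follows the history `h`. -/
noncomputable def nextBroadcasters (κ : ℕ) (A : Adversary) (h : List (Finset Packet))
    (ω : Coins) : Finset Packet :=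
  (replay κ A h).broadcasters A h.length fun j => ω (h.length, j)

lemma hist_length (κ : ℕ) (A : Adversary) (ω : Coins) (t : ℕ) : (hist κ A ω t).length = t :=
  (run_eq_replay κ A ω t).1

lemma replay_hist (κ : ℕ) (A : Adversary) (ω : Coins) (t : ℕ) :
    replay κ A (hist κ A ω t) = run κ A ω t :=
  (run_eq_replay κ A ω t).2.symm

lemma hist_succ (κ : ℕ) (A : Adversary) (ω : Coins) (t : ℕ) :
    hist κ A ω (t + 1) = nextBroadcasters κ A (hist κ A ω t) ω :: hist κ A ω t := by
  rw [nextBroadcasters, replay_hist, hist_length]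
  rfl

lemma drop_hist (κ : ℕ) (A : Adversary) (ω : Coins) (s k : ℕ) :
    (hist κ A ω (s + k)).drop k = hist κ A ω s := by
  induction k with
  | zero => rfl
  | succ k ih => rw [← add_assoc, hist_succ, List.drop_succ_cons, ih]

lemma legal_nextBroadcasters {κ : ℕ} {A : Adversary} {h : List (Finset Packet)}
    (hI : (replay κ A h).Inv κ h.length) (ω : Coins) :
    (replay κ A h).Legal (nextBroadcasters κ A h ω) := by
  classical
  constructor
  · intro he j hj
    rw [nextBroadcasters, State.broadcasters, if_pos he, Finset.mem_filter] at hj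
    have hne : (replay κ A h).prob j ≠ 0 := fun h0 => by
      have := (ω (h.length, j)).2.1
      linarith [hj.2]
    exact ⟨by_contra fun hns => hne (hI.prob_eq_zero j hns), hne⟩
  · intro he
    rw [nextBroadcasters, State.broadcasters, if_neg he.ne']

lemma legalHistory_hist {κ : ℕ} (hκ : 2 ≤ κ) (A : Adversary) (ω : Coins) (t : ℕ) :
    LegalHistory κ A (hist κ A ω t) := by
  induction t with
  | zero => exact trivial
  | succ t ih =>
    rw [hist_succ]
    exact ⟨ih, legal_nextBroadcasters (ih.inv hκ) ω⟩

lemma measurableSet_hist_eq (κ : ℕ) (A : Adversary) (t : ℕ) (h : List (Finset Packet)) :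
    MeasurableSet[coinAlgebra (Set.Iio t)] {ω | hist κ A ω t = h} := by
  induction t generalizing h with
  | zero => exact MeasurableSet.const ([] = h)
  | succ t ih =>
    cases h with
    | nil =>
      have : {ω : Coins | hist κ A ω (t + 1) = []} = ∅ := by
        ext ω
        simp [hist_succ]
      rw [this]
      exact @MeasurableSet.empty _ (coinAlgebra _)
    | cons B h =>
      by_cases ht : h.length = t
      · have : {ω : Coins | hist κ A ω (t + 1) = B :: h} = {ω | hist κ A ω t = h} ∩
            {ω | (replay κ A h).broadcasters A t (fun j => ω (t, j)) = B} := by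
          ext ω
          simp only [hist_succ, List.cons.injEq, Set.mem_ofPred_eq, Set.mem_inter_iff]
          constructor
          · rintro ⟨h1, h2⟩
            rw [h2, nextBroadcasters, ht] at h1
            exact ⟨h2, h1⟩
          · rintro ⟨h1, h2⟩
            rw [h1, nextBroadcasters, ht]
            exact ⟨h2, rfl⟩
        rw [this]
        refine MeasurableSet.inter ?_ ?_
        · exact coinAlgebra_mono (Set.Iio_subset_Iio (Nat.le_succ t)) _ (ih h)
        · exact coinAlgebra_mono (by simp) _ (measurableSet_broadcasters (replay κ A h) A t B)
      · have : {ω : Coins | hist κ A ω (t + 1) = B :: h} = ∅ := by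
          ext ω
          simp only [hist_succ, List.cons.injEq, Set.mem_ofPred_eq, Set.mem_empty_iff_false,
            iff_false]
          rintro ⟨-, h2⟩
          exact ht (by rw [← h2, hist_length])
        rw [this]
        exact @MeasurableSet.empty _ (coinAlgebra _)

/-- The expectation of a function of a variable with countably many values. -/
lemma lintegral_eq_tsum_of_countable {Ω α : Type*} [MeasurableSpace Ω] (μ : Measure Ω)
    [Countable α] {V : Ω → α} (hV : ∀ a, MeasurableSet {ω | V ω = a}) (F : α → ℝ≥0∞) :
    ∫⁻ ω, F (V ω) ∂μ = ∑' a, F a * μ {ω | V ω = a} := by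
  let _ : MeasurableSpace α := ⊤
  have hm : Measurable V := measurable_to_countable' fun a => hV a
  rw [← lintegral_map (f := F) measurable_from_top hm, lintegral_countable']
  congr 1
  ext a
  rw [Measure.map_apply hm (MeasurableSet.singleton a)]
  rfl

lemma measurable_hist {β : Type*} [MeasurableSpace β] (κ : ℕ) (A : Adversary) (t : ℕ)
    (F : List (Finset Packet) → β) : Measurable fun ω => F (hist κ A ω t) := by
  let _ : MeasurableSpace (List (Finset Packet)) := ⊤
  have hm : Measurable fun ω => hist κ A ω t := measurable_to_countable' fun a =>
    coinAlgebra_le _ _ (measurableSet_hist_eq κ A t a)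
  exact measurable_from_top.comp hm

lemma measurableSet_nextBroadcasters_eq (κ : ℕ) (A : Adversary) (h : List (Finset Packet))
    (B : Finset Packet) :
    MeasurableSet[coinAlgebra {h.length}] {ω | nextBroadcasters κ A h ω = B} :=
  measurableSet_broadcasters (replay κ A h) A h.length B

/-- The Markov property: the coins of a slot are independent of the history before it. -/
lemma measure_hist_inter_next (κ : ℕ) (A : Adversary) (h : List (Finset Packet))
    (B : Finset Packet) :
    coinMeasure ({ω | hist κ A ω h.length = h} ∩ {ω | nextBroadcasters κ A h ω = B}) =
      coinMeasure {ω | hist κ A ω h.length = h} *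
        coinMeasure {ω | nextBroadcasters κ A h ω = B} := by
  have hind := indep_coinAlgebra (T := Set.Iio h.length) (T' := {h.length}) (by simp)
  rw [Indep_iff] at hind
  exact hind _ _ (measurableSet_hist_eq κ A _ h) (measurableSet_nextBroadcasters_eq κ A h B)

/-- The expectation of a function of the next history, conditioned on the present one. -/
lemma lintegral_hist_succ (κ : ℕ) (A : Adversary) (t : ℕ) (Z : List (Finset Packet) → ℝ≥0∞) :
    ∫⁻ ω, Z (hist κ A ω (t + 1)) ∂coinMeasure =
      ∑' h, coinMeasure {ω | hist κ A ω t = h} *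
        ∫⁻ ω, Z (nextBroadcasters κ A h ω :: h) ∂coinMeasure := by
  have hset : ∀ a : List (Finset Packet) × Finset Packet,
      {ω | (hist κ A ω t, nextBroadcasters κ A (hist κ A ω t) ω) = a} =
        {ω | hist κ A ω t = a.1} ∩ {ω | nextBroadcasters κ A a.1 ω = a.2} := by
    rintro ⟨h, B⟩
    ext ω
    simp only [Prod.mk.injEq, Set.mem_ofPred_eq, Set.mem_inter_iff]
    constructor
    · rintro ⟨rfl, h2⟩
      exact ⟨rfl, h2⟩
    · rintro ⟨rfl, h2⟩
      exact ⟨rfl, h2⟩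
  have hm1 : ∀ h, MeasurableSet {ω | hist κ A ω t = h} := fun h =>
    coinAlgebra_le _ _ (measurableSet_hist_eq κ A t h)
  have hm2 : ∀ h B, MeasurableSet {ω | nextBroadcasters κ A h ω = B} := fun h B =>
    coinAlgebra_le _ _ (measurableSet_nextBroadcasters_eq κ A h B)
  have h1 := lintegral_eq_tsum_of_countable coinMeasure
    (V := fun ω => (hist κ A ω t, nextBroadcasters κ A (hist κ A ω t) ω))
    (fun a => by
      rw [hset]
      exact (hm1 a.1).inter (hm2 a.1 a.2))
    (fun a => Z (a.2 :: a.1))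
  simp_rw [hist_succ]
  rw [h1, ENNReal.tsum_prod']
  congr 1
  ext h
  rw [lintegral_eq_tsum_of_countable coinMeasure (V := nextBroadcasters κ A h) (hm2 h)
    (fun B => Z (B :: h)), ← ENNReal.tsum_mul_left]
  congr 1
  ext B
  rw [hset]
  by_cases ht : h.length = t
  · have := measure_hist_inter_next κ A h B
    rw [ht] at this
    rw [this]
    ring
  · have : {ω | hist κ A ω t = h} = ∅ := by
      ext ω
      simp only [Set.mem_ofPred_eq, Set.mem_empty_iff_false, iff_false]
      rintro rfl
      exact ht (hist_length κ A ω t)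
    simp [this]

/-! ### The exponential supermartingale -/

/-- The conditional expectation of the exponential of the balance does not increase. -/
lemma lintegral_exp_balance_cons_le {κ w : ℕ} (hκ : 144 ≤ κ) (hw : 16 * κ ^ 2 ≤ w) {A : Adversary}
    {h : List (Finset Packet)} (hh : LegalHistory κ A h) (y : ℝ) :
    ∫⁻ ω, ENNReal.ofReal
        (Real.exp (tailRate κ * (balance κ w A (nextBroadcasters κ A h ω :: h) - y))) ∂coinMeasure ≤
      ENNReal.ofReal (Real.exp (tailRate κ * (balance κ w A h - y))) := by
  classical
  have hI := hh.inv (by omega : 2 ≤ κ)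
  set s := replay κ A h with hs
  set S : Set Coins := {ω | s.Atypical κ (nextBroadcasters κ A h ω)} with hS
  set G := Real.exp (tailRate κ * (balance κ w A h - y)) with hG
  set d := Real.exp (-(tailRate κ * (3 / Real.log κ))) with hd
  set r := Real.exp (1 / 2) - 1 with hr
  have hr0 : 0 ≤ r := by
    have := Real.add_one_le_exp (1 / 2 : ℝ)
    rw [hr]
    linarith
  have hpt : ∀ ω, ENNReal.ofReal
      (Real.exp (tailRate κ * (balance κ w A (nextBroadcasters κ A h ω :: h) - y))) ≤
      ENNReal.ofReal (G * d) * (1 + ENNReal.ofReal r * S.indicator 1 ω) := by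
    intro ω
    have hb := LegalHistory.balance_cons_le hκ hw
      (show LegalHistory κ A (nextBroadcasters κ A h ω :: h) from ⟨hh, legal_nextBroadcasters hI ω⟩)
    have hmul := mul_le_mul_of_nonneg_left (sub_le_sub_right hb y) (tailRate_pos κ).le
    by_cases hω : ω ∈ S
    · have hl : s.loss κ (nextBroadcasters κ A h ω) = κ + 2 := if_pos hω
      have hhalf : tailRate κ * (κ + 2) = 1 / 2 := by
        unfold tailRate
        field_simp
      rw [Set.indicator_of_mem hω, Pi.one_apply, mul_one, ← ENNReal.ofReal_one,
        ← ENNReal.ofReal_add zero_le_one hr0, ← ENNReal.ofReal_mul (by positivity)]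
      apply ENNReal.ofReal_le_ofReal
      rw [show (1 : ℝ) + r = Real.exp (1 / 2) by rw [hr]; ring, hG, hd, ← Real.exp_add,
        ← Real.exp_add]
      apply Real.exp_le_exp.2
      rw [← hs, hl] at hmul
      linarith
    · have hl : s.loss κ (nextBroadcasters κ A h ω) = 0 := if_neg hω
      rw [Set.indicator_of_notMem hω, mul_zero, add_zero, mul_one]
      apply ENNReal.ofReal_le_ofReal
      rw [hG, hd, ← Real.exp_add]
      apply Real.exp_le_exp.2
      rw [← hs, hl] at hmul
      linarith
  have hSm : MeasurableSet S := by
    have : S = ⋃ B : Finset Packet, ⋃ _ : s.Atypical κ B, {ω | nextBroadcasters κ A h ω = B} := by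
      ext ω
      simp [hS]
    rw [this]
    exact MeasurableSet.iUnion fun B => MeasurableSet.iUnion fun _ =>
      coinAlgebra_le _ _ (measurableSet_nextBroadcasters_eq κ A h B)
  have hSle : coinMeasure S ≤ ENNReal.ofReal
      (Real.exp (-(√(κ : ℝ) / 2)) + Real.exp ((κ : ℝ) / 2) * 2⁻¹ ^ κ) := by
    by_cases he : s.elapsed = 0
    · have hsub : S ⊆ {ω | nextBroadcasters κ A h ω = ∅ ∧ √(κ : ℝ) / 2 < s.load} ∪
          {ω | κ < (nextBroadcasters κ A h ω).card ∧ s.load < (κ : ℝ) / 2} := fun ω hω => hω.2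
      rw [ENNReal.ofReal_add (by positivity) (by positivity)]
      refine (measure_mono hsub).trans ((measure_union_le _ _).trans (add_le_add ?_ ?_))
      · by_cases hx : √(κ : ℝ) / 2 < s.load
        · refine (measure_mono fun ω hω => hω.1).trans
            ((hI.measure_broadcasters_eq_empty_le A he).trans ?_)
          apply ENNReal.ofReal_le_ofReal
          apply Real.exp_le_exp.2
          linarith
        · simp [hx]
      · by_cases hx : s.load < (κ : ℝ) / 2
        · refine (measure_mono fun ω hω => hω.1).trans
            ((hI.measure_lt_card_broadcasters_le A he).trans ?_)
          apply ENNReal.ofReal_le_ofReal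
          gcongr
        · simp [hx]
    · have : S = ∅ := by
        ext ω
        simp [hS, State.Atypical, he]
      simp [this]
  calc _ ≤ ∫⁻ ω, ENNReal.ofReal (G * d) * (1 + ENNReal.ofReal r * S.indicator 1 ω) ∂coinMeasure :=
        lintegral_mono hpt
    _ = ENNReal.ofReal (G * d) * (1 + ENNReal.ofReal r * coinMeasure S) := by
        have hi : Measurable fun ω : Coins => S.indicator (1 : Coins → ℝ≥0∞) ω :=
          measurable_one.indicator hSm
        rw [lintegral_const_mul _ (by fun_prop), lintegral_add_left (by fun_prop),
          lintegral_const_mul _ hi, lintegral_indicator_one hSm]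
        simp
    _ ≤ ENNReal.ofReal (G * d) * ENNReal.ofReal (1 + r *
          (Real.exp (-(√(κ : ℝ) / 2)) + Real.exp ((κ : ℝ) / 2) * 2⁻¹ ^ κ)) := by
        rw [ENNReal.ofReal_add zero_le_one (by positivity), ENNReal.ofReal_mul hr0,
          ENNReal.ofReal_one]
        gcongr
    _ ≤ ENNReal.ofReal (G * d) * ENNReal.ofReal (Real.exp (tailRate κ * (3 / Real.log κ))) := by
        gcongr
        exact atypical_le hκ
    _ = ENNReal.ofReal G := by
        rw [← ENNReal.ofReal_mul (by positivity), mul_assoc, hd, ← Real.exp_add]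
        simp

/-- From any slot `s` on, the exponential of the growth of the balance has expectation at most
`1`. -/
lemma lintegral_exp_balance_sub_le {κ w : ℕ} (hκ : 144 ≤ κ) (hw : 16 * κ ^ 2 ≤ w) (A : Adversary)
    (s k : ℕ) :
    ∫⁻ ω, ENNReal.ofReal (Real.exp (tailRate κ *
      (balance κ w A (hist κ A ω (s + k)) - balance κ w A (hist κ A ω s)))) ∂coinMeasure ≤ 1 := by
  induction k with
  | zero => simp
  | succ k ih =>
    -- the history before slot `s` is a final segment of the one before slot `s + k`
    set Z : ℕ → List (Finset Packet) → ℝ≥0∞ := fun k h => ENNReal.ofReal (Real.exp (tailRate κ *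
      (balance κ w A h - balance κ w A (h.drop k)))) with hZ
    have hZk : ∀ k ω, ENNReal.ofReal (Real.exp (tailRate κ *
        (balance κ w A (hist κ A ω (s + k)) - balance κ w A (hist κ A ω s)))) =
        Z k (hist κ A ω (s + k)) := fun k ω => by rw [hZ, ← drop_hist κ A ω s k]
    simp_rw [hZk] at ih ⊢
    refine le_trans ?_ ih
    rw [← add_assoc, lintegral_hist_succ,
      lintegral_eq_tsum_of_countable coinMeasure
        (fun h => coinAlgebra_le _ _ (measurableSet_hist_eq κ A (s + k) h))]
    apply ENNReal.tsum_le_tsum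
    intro h
    by_cases hh : LegalHistory κ A h
    · rw [mul_comm]
      gcongr
      exact lintegral_exp_balance_cons_le hκ hw hh _
    · have : {ω | hist κ A ω (s + k) = h} = ∅ := by
        ext ω
        simp only [Set.mem_ofPred_eq, Set.mem_empty_iff_false, iff_false]
        rintro rfl
        exact hh (legalHistory_hist (by omega) A ω _)
      simp [this]

/-- The tail bound for the growth of the balance between two slots. -/
lemma measure_balance_sub_ge_le {κ w : ℕ} (hκ : 144 ≤ κ) (hw : 16 * κ ^ 2 ≤ w) (A : Adversary)
    (s k : ℕ) (y : ℝ) :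
    coinMeasure {ω | y ≤ balance κ w A (hist κ A ω (s + k)) - balance κ w A (hist κ A ω s)} ≤
      ENNReal.ofReal (Real.exp (-(tailRate κ * y))) := by
  have hm : Measurable fun ω => ENNReal.ofReal (Real.exp (tailRate κ *
      (balance κ w A (hist κ A ω (s + k)) - balance κ w A (hist κ A ω s)))) := by
    have h1 := measurable_hist κ A (s + k) (balance κ w A)
    have h2 := measurable_hist κ A s (balance κ w A)
    fun_prop
  have h := (mul_meas_ge_le_lintegral hm (ENNReal.ofReal (Real.exp (tailRate κ * y)))).trans
    (lintegral_exp_balance_sub_le hκ hw A s k)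
  have hsub : {ω | y ≤ balance κ w A (hist κ A ω (s + k)) - balance κ w A (hist κ A ω s)} ⊆
      {ω | ENNReal.ofReal (Real.exp (tailRate κ * y)) ≤ ENNReal.ofReal (Real.exp (tailRate κ *
        (balance κ w A (hist κ A ω (s + k)) - balance κ w A (hist κ A ω s))))} := by
    intro ω hω
    apply ENNReal.ofReal_le_ofReal
    apply Real.exp_le_exp.2
    exact mul_le_mul_of_nonneg_left hω (tailRate_pos κ).le
  refine (measure_mono hsub).trans ?_
  rw [Real.exp_neg, ENNReal.ofReal_inv_of_pos (Real.exp_pos _), ← one_div,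
    ENNReal.le_div_iff_mul_le (.inl (by simp [Real.exp_pos])) (.inl (by simp)), mul_comm]
  exact h

/-! ### Bounds on the potential -/

lemma State.Inv.card_sub_le_potential {κ t : ℕ} (hκ : 144 ≤ κ) {s : State} (hs : s.Inv κ t) :
    (s.system.card : ℝ) - κ ≤ s.potential κ := by
  have hκ1 : (0 : ℝ) ≤ κ + 1 := by positivity
  have hI : 0 ≤ price κ * s.inactive := mul_nonneg (price_pos hκ).le (Nat.cast_nonneg _)
  have h1 := mul_nonneg hκ1 (excess_nonneg κ s.load)
  have h2 := mul_nonneg hκ1 (excess_nonneg κ (s.load / ratio κ))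
  unfold State.potential State.epochCost
  split_ifs with he hc
  · linarith
  · have : (s.elapsed : ℝ) ≤ κ := by
      exact_mod_cast ((hs.elapsed_lt_card (by omega) hc).trans_le hc).le
    linarith
  · have : (s.elapsed : ℝ) ≤ κ := by
      exact_mod_cast (hs.elapsed_lt (by omega) (by omega)).le
    linarith

lemma State.Inv.potential_le {κ t : ℕ} (hκ : 144 ≤ κ) {s : State} (hs : s.Inv κ t) :
    s.potential κ ≤ (1 + price κ) * s.system.card + (κ + 1) * excess κ s.load + (κ + 1) := by
  have hκ1 : (0 : ℝ) ≤ κ + 1 := by positivity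
  have hI : (s.inactive : ℝ) ≤ s.system.card := by exact_mod_cast Finset.card_filter_le _ _
  have hI' := mul_le_mul_of_nonneg_left hI (price_pos hκ).le
  have hx := hs.load_nonneg
  have hq := ratio_pos hκ
  have hle : s.load / ratio κ ≤ s.load := div_le_self hx (by linarith [three_le_ratio hκ])
  have h2 := mul_le_mul_of_nonneg_left (excess_mono hκ (by positivity) hle) hκ1
  have h3 : (0 : ℝ) ≤ s.elapsed := Nat.cast_nonneg _
  unfold State.potential State.epochCost
  split_ifs with he hc <;> linarith

lemma price_le {κ : ℕ} (hκ : 144 ≤ κ) (hx : 5 ≤ Real.log κ) : price κ ≤ 0.6 := by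
  have hq := three_le_ratio hκ
  rw [price, div_le_iff₀ (by positivity)]
  nlinarith

/-- The arrival rate, including the price of the arrivals, leaves room for the gain of `3 / ln κ`
per slot that compensates for atypical slots, and for another `1 / ln κ`. -/
lemma one_add_price_mul_rate_le {κ : ℕ} (hκ : 144 ≤ κ) (hx : 5 ≤ Real.log κ) :
    (1 + price κ) * (1 - 5 / Real.log κ) ≤ 1 - 4 / Real.log κ := by
  have hlog := log_ratio κ
  have hqp := ratio_pos hκ
  have hq : Real.exp (Real.log κ / 4) = ratio κ := by
    rw [hlog, mul_div_cancel_left₀ _ (by norm_num), Real.exp_log hqp]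
  set x := Real.log κ with hxdef
  have hexp := taylor_three_le_exp (show 0 ≤ x / 4 by positivity)
  rw [hq] at hexp
  have h1 : 9 * (x - 5) ≤ ratio κ * x := by
    have h2 : (1 + x / 4 + (x / 4) ^ 2 / 2) * x ≤ ratio κ * x := by
      gcongr
      have : 0 ≤ (x / 4) ^ 3 / 6 := by positivity
      linarith
    nlinarith [mul_nonneg (sub_nonneg.2 hx) (sq_nonneg (x - 7)), sq_nonneg (x - 7)]
  have h3 : price κ * (1 - 5 / x) ≤ 1 / x := by
    rw [price, ← hxdef]
    have e : 9 / (ratio κ * x) * (1 - 5 / x) = 9 * (x - 5) / (ratio κ * x * x) := by field_simp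
    rw [e, div_le_div_iff₀ (by positivity) (by positivity)]
    nlinarith
  have e : 1 - 4 / x = 1 - 5 / x + 1 / x := by ring
  rw [e]
  linarith

/-! ### Arrivals -/

lemma sum_arrivals_Ico_mul_le {f : ℕ → ℕ} {w : ℕ} {r : ℝ}
    (hf : ∀ s, ((∑ t ∈ Finset.Ico s (s + w), f t : ℕ) : ℝ) ≤ r * w) (s n : ℕ) :
    ((∑ t ∈ Finset.Ico s (s + n * w), f t : ℕ) : ℝ) ≤ r * (n * w) := by
  induction n with
  | zero => simp
  | succ n ih =>
    have e : s + (n + 1) * w = s + n * w + w := by ring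
    rw [e, ← Finset.sum_Ico_consecutive f (Nat.le_add_right s (n * w)) (Nat.le_add_right _ w)]
    have := hf (s + n * w)
    push_cast at this ih ⊢
    linarith

/-- A window of any length `k` is covered by windows of length `w` of total length at most
`k + w`. -/
lemma sum_arrivals_Ico_le {f : ℕ → ℕ} {w : ℕ} (hw : 0 < w) {r : ℝ} (hr : 0 ≤ r)
    (hf : ∀ s, ((∑ t ∈ Finset.Ico s (s + w), f t : ℕ) : ℝ) ≤ r * w) (s k : ℕ) :
    ((∑ t ∈ Finset.Ico s (s + k), f t : ℕ) : ℝ) ≤ r * (k + w) := by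
  have h1 : k ≤ (k / w + 1) * w := by
    have := Nat.lt_div_mul_add hw (a := k)
    rw [add_mul]
    omega
  have h2 : (k / w + 1) * w ≤ k + w := by
    have := Nat.div_mul_le_self k w
    rw [add_mul]
    omega
  have h3 : ∑ t ∈ Finset.Ico s (s + k), f t ≤ ∑ t ∈ Finset.Ico s (s + (k / w + 1) * w), f t :=
    Finset.sum_le_sum_of_subset (Finset.Ico_subset_Ico le_rfl (by omega))
  have h4 := sum_arrivals_Ico_mul_le hf s (k / w + 1)
  calc ((∑ t ∈ Finset.Ico s (s + k), f t : ℕ) : ℝ)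
      ≤ (∑ t ∈ Finset.Ico s (s + (k / w + 1) * w), f t : ℕ) := by exact_mod_cast h3
    _ ≤ r * ((k / w + 1 : ℕ) * w) := h4
    _ ≤ r * (k + w) := by
        gcongr
        exact_mod_cast h2

lemma injected_hist (κ : ℕ) (A : Adversary) (ω : Coins) (s k : ℕ) :
    injected A (hist κ A ω (s + k)) =
      injected A (hist κ A ω s) + ∑ t ∈ Finset.Ico s (s + k), arrivals κ A ω t := by
  induction k with
  | zero => simp
  | succ k ih =>
    rw [← add_assoc, hist_succ, injected, ih, Finset.sum_Ico_succ_top (Nat.le_add_right s k)]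
    rw [add_assoc]
    rfl

/-! ### The course of a packet -/

/-- Almost surely no coin shows exactly `1`, so a packet with joining probability at least `1`
joins every epoch. -/
lemma ae_coin_lt_one : ∀ᵐ ω ∂coinMeasure, ∀ (t : ℕ) (j : Packet), (ω (t, j) : ℝ) < 1 := by
  rw [ae_all_iff]
  intro t
  rw [ae_all_iff]
  intro j
  have h := coinMeasure_forall_mem t {j} (E := fun _ => {u : unitInterval | ¬ (u : ℝ) < 1})
    fun _ => (measurableSet_lt measurable_subtype_coe measurable_const).compl
  have e : {u : unitInterval | ¬ (u : ℝ) < 1} = Set.Ici 1 := by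
    ext u
    simp [← Subtype.coe_le_coe]
  rw [Finset.prod_singleton, e, unitInterval.volume_Ici] at h
  rw [ae_iff]
  convert h using 1
  · congr 1
    ext ω
    simp [← Subtype.coe_le_coe]
  · simp

lemma prob_lt_ratio {κ : ℕ} (hκ : 144 ≤ κ) (A : Adversary) {ω : Coins}
    (hω : ∀ (t : ℕ) (j : Packet), (ω (t, j) : ℝ) < 1) (t : ℕ) (j : Packet) :
    (run κ A ω t).prob j < ratio κ := by
  classical
  have hq3 := three_le_ratio hκ
  have hq := ratio_pos hκ
  induction t generalizing j with
  | zero => exact hq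
  | succ t ih =>
    have hI := (legalHistory_hist (by omega : 2 ≤ κ) A ω t).inv (by omega)
    have hL := legal_nextBroadcasters hI ω
    have hb : nextBroadcasters κ A (hist κ A ω t) ω =
        (run κ A ω t).broadcasters A t fun j => ω (t, j) := by
      rw [nextBroadcasters, replay_hist, hist_length]
    rw [hb] at hL
    rw [replay_hist] at hI hL
    rw [hist_length] at hI
    obtain ⟨hcase, -⟩ := hI.slotCase (by omega) hL
    change ((run κ A ω t).step κ A t fun j => ω (t, j)).prob j < ratio κ
    unfold State.step State.delivered State.slotOutcome
    simp only
    set s := run κ A ω t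
    set B := s.broadcasters A t fun j => ω (t, j) with hB
    generalize outcome κ B (B :: s.log) (s.elapsed + 1) = O at hcase ⊢
    generalize decoded κ (B :: s.log) = D at hcase ⊢
    split_ifs with hj
    · cases hcase with
      | silent h0 he =>
        by_cases hp : s.prob j = 0
        · rw [updateProb, if_pos hp]
          have h12 := twelve_le_sqrt hκ
          have : 1 / √(κ : ℝ) ≤ 1 := by
            rw [div_le_one (by positivity)]
            linarith
          linarith
        · rw [updateProb, if_neg hp]
          have hle : s.prob j < 1 := by
            by_contra hcon
            have hmem : j ∈ B := by
              rw [hB, State.broadcasters, if_pos he, Finset.mem_filter]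
              exact ⟨(Finset.mem_sdiff.1 hj).1, by linarith [hω t j]⟩
            rw [h0] at hmem
            simp at hmem
          change s.prob j * ratio κ < ratio κ
          nlinarith
      | progress hg h => exact ih j
      | success hg h => exact ih j
      | jam hgt h => exact ih j
      | overfull hgt h =>
        change s.prob j / ratio κ < ratio κ
        exact (div_le_self (hI.prob_nonneg j) (by linarith)).trans_lt (ih j)
    · exact hq

/-- As long as a packet is in the system, its joining probability follows the drift since its
arrival; it lags behind by at most three steps, as it starts at depth `2` and becomes active with
the first silent slot. -/
lemma prob_of_not_delivered {κ : ℕ} (hκ : 144 ≤ κ) (A : Adversary) (ω : Coins) {j : Packet}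
    (hj : j.2 < arrivals κ A ω j.1) (k : ℕ)
    (hnd : ∀ T, j.1 ≤ T → T < j.1 + k → j ∉ deliveredIn κ A ω T) :
    j ∈ inSystem κ A ω (j.1 + k) ∧
      (((run κ A ω (j.1 + k)).prob j = 0 ∧
        netDrift κ A (hist κ A ω (j.1 + k)) ≤ netDrift κ A (hist κ A ω j.1)) ∨
      ((run κ A ω (j.1 + k)).prob j ≠ 0 ∧
        ratio κ ^ (netDrift κ A (hist κ A ω (j.1 + k)) - netDrift κ A (hist κ A ω j.1) - 3) ≤
          (run κ A ω (j.1 + k)).prob j)) := by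
  classical
  have hq := ratio_pos hκ
  have hq1 : 1 ≤ ratio κ := by linarith [three_le_ratio hκ]
  induction k with
  | zero =>
    have hI := (legalHistory_hist (by omega : 2 ≤ κ) A ω j.1).inv (by omega)
    rw [replay_hist, hist_length] at hI
    refine ⟨State.mem_present.2 (.inr ⟨rfl, hj⟩), .inl ⟨?_, le_rfl⟩⟩
    exact hI.prob_eq_zero j fun h => lt_irrefl _ (hI.fresh j h)
  | succ k ih =>
    obtain ⟨hin, hprob⟩ := ih fun T h1 h2 => hnd T h1 (by omega)
    have hnot := hnd (j.1 + k) (by omega) (by omega)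
    set t := j.1 + k with ht
    have hsys : j ∈ (run κ A ω (t + 1)).system := Finset.mem_sdiff.2 ⟨hin, hnot⟩
    rw [show j.1 + (k + 1) = t + 1 by omega]
    refine ⟨State.mem_present.2 (.inl hsys), ?_⟩
    have hO : outcomeAfter κ A (hist κ A ω t) (nextBroadcasters κ A (hist κ A ω t) ω) =
        (run κ A ω t).slotOutcome κ A t fun j => ω (t, j) := by
      rw [outcomeAfter, nextBroadcasters, replay_hist, hist_length]
      rfl
    have hp : (run κ A ω (t + 1)).prob j = updateProb κ ((run κ A ω t).prob j)
        (outcomeAfter κ A (hist κ A ω t) (nextBroadcasters κ A (hist κ A ω t) ω)) := by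
      rw [hO]
      exact if_pos hsys
    rw [hist_succ, netDrift, hp]
    generalize outcomeAfter κ A (hist κ A ω t) (nextBroadcasters κ A (hist κ A ω t) ω) = O
    rcases hprob with ⟨h0, hle⟩ | ⟨h0, hle⟩
    · rw [h0]
      by_cases hz : updateProb κ 0 O = 0
      · refine .inl ⟨hz, ?_⟩
        have : O.drift ≤ 0 := by
          cases O <;> simp_all [Outcome.drift, updateProb]
        omega
      · refine .inr ⟨hz, ?_⟩
        obtain ⟨rfl, h2⟩ := updateProb_zero hz
        rw [h2]
        apply zpow_le_zpow_right₀ hq1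
        simp only [Outcome.drift]
        omega
    · rw [updateProb_of_ne_zero h0]
      refine .inr ⟨mul_ne_zero h0 (zpow_ne_zero _ hq.ne'), ?_⟩
      calc ratio κ ^ (netDrift κ A (hist κ A ω t) + O.drift - netDrift κ A (hist κ A ω j.1) - 3)
          = ratio κ ^ (netDrift κ A (hist κ A ω t) - netDrift κ A (hist κ A ω j.1) - 3) *
            ratio κ ^ O.drift := by
            rw [← zpow_add₀ hq.ne']
            congr 1
            ring
        _ ≤ _ := by gcongr

/-- A packet that stays in the system would be driven above the largest possible joining
probability by four more silent than overfull epochs. -/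
lemma netDrift_lt_of_not_delivered {κ : ℕ} (hκ : 144 ≤ κ) (A : Adversary) {ω : Coins}
    (hω : ∀ (t : ℕ) (j : Packet), (ω (t, j) : ℝ) < 1) {j : Packet}
    (hj : j.2 < arrivals κ A ω j.1) (k : ℕ)
    (hnd : ∀ T, j.1 ≤ T → T < j.1 + k → j ∉ deliveredIn κ A ω T) :
    netDrift κ A (hist κ A ω (j.1 + k)) < netDrift κ A (hist κ A ω j.1) + 4 := by
  by_contra hcon
  have hq1 : 1 ≤ ratio κ := by linarith [three_le_ratio hκ]
  obtain ⟨-, ⟨-, h⟩ | ⟨-, h⟩⟩ := prob_of_not_delivered hκ A ω hj k hnd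
  · omega
  · have h1 := prob_lt_ratio hκ A hω (j.1 + k) j
    have h2 : ratio κ ^ (1 : ℤ) ≤ ratio κ ^
        (netDrift κ A (hist κ A ω (j.1 + k)) - netDrift κ A (hist κ A ω j.1) - 3) :=
      zpow_le_zpow_right₀ hq1 (by omega)
    rw [zpow_one] at h2
    linarith

/-! ### Looking back to the last idle slot -/

/-- Since the last idle slot `s ≤ t`, there has been at most one idle silent slot, namely `s`. The
empty system before slot `0` is idle. -/
lemma exists_idle (κ w : ℕ) (A : Adversary) (ω : Coins) (t : ℕ) :
    ∃ s ≤ t, Idle κ w A (hist κ A ω s) ∧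
      idleCount κ w A (hist κ A ω t) ≤ idleCount κ w A (hist κ A ω s) + 1 := by
  induction t with
  | zero =>
    refine ⟨0, le_rfl, ⟨rfl, ?_⟩, Nat.le_succ _⟩
    rw [replay_hist]
    simp [run, State.init]
  | succ t ih =>
    by_cases hid : Idle κ w A (hist κ A ω t)
    · refine ⟨t, Nat.le_succ t, hid, ?_⟩
      rw [hist_succ, idleCount]
      split_ifs <;> omega
    · obtain ⟨s, hs, hs', hle⟩ := ih
      refine ⟨s, by omega, hs', ?_⟩
      rw [hist_succ, idleCount, if_neg fun h => hid h.2]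
      exact hle

/-- In an idle state the potential is small. -/
lemma potential_le_of_idle {κ w : ℕ} (hκ : 144 ≤ κ) (hw : 16 * κ ^ 2 ≤ w)
    (hx : 5 ≤ Real.log κ) (A : Adversary) {ω : Coins}
    (hω : ∀ (t : ℕ) (j : Packet), (ω (t, j) : ℝ) < 1) {s : ℕ}
    (hs : Idle κ w A (hist κ A ω s)) :
    (replay κ A (hist κ A ω s)).potential κ ≤ 0.61 * w := by
  have hI := (legalHistory_hist (by omega : 2 ≤ κ) A ω s).inv (by omega)
  have hpot := hI.potential_le hκ
  have hcard : (4 : ℝ) * (replay κ A (hist κ A ω s)).system.card ≤ w := by exact_mod_cast hs.2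
  have hprob : ∀ j, (replay κ A (hist κ A ω s)).prob j ≤ ratio κ := fun j => by
    rw [replay_hist]
    exact (prob_lt_ratio hκ A hω s j).le
  set S := replay κ A (hist κ A ω s)
  have hq := ratio_pos hκ
  have hq3 := three_le_ratio hκ
  have hκ' : (144 : ℝ) ≤ κ := by exact_mod_cast hκ
  have hw' : (16 : ℝ) * κ ^ 2 ≤ w := by exact_mod_cast hw
  have hw0 : (0 : ℝ) < w := by nlinarith
  set v := √(w : ℝ) with hv
  have hvsq : v ^ 2 = w := Real.sq_sqrt hw0.le
  have hκv : 4 * (κ : ℝ) ≤ v := Real.le_sqrt_of_sq_le (by linarith)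
  have hload : S.load ≤ w / 4 * ratio κ := by
    calc S.load ≤ S.system.card • ratio κ := Finset.sum_le_card_nsmul _ _ _ fun j _ => hprob j
      _ = S.system.card * ratio κ := nsmul_eq_mul _ _
      _ ≤ _ := by gcongr; linarith
  have hexc : excess κ S.load ≤ 0.8 * v := by
    refine (excess_mono hκ hI.load_nonneg hload).trans (max_le (by positivity) ?_)
    have hl : 5 / 4 ≤ Real.log (ratio κ) := by
      have := log_ratio κ
      linarith
    rw [div_le_iff₀ (by linarith)]
    have h1 : 2 * (w / 4 * ratio κ) / ratio κ ^ 3 ≤ w := by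
      rw [div_le_iff₀ (by positivity)]
      have : ratio κ ≤ ratio κ ^ 3 := by
        have := pow_le_pow_right₀ (by linarith : 1 ≤ ratio κ) (by norm_num : 1 ≤ 3)
        simpa using this
      nlinarith
    have h2 : Real.log w ≤ v := by
      rw [← hvsq, Real.log_pow]
      have h3 := Real.log_le_sub_one_of_pos (show 0 < v / 2 by linarith)
      rw [Real.log_div (by linarith) (by norm_num)] at h3
      have := Real.log_two_lt_d9
      push_cast
      linarith
    calc _ ≤ Real.log w := Real.log_le_log (by positivity) h1
      _ ≤ v := h2
      _ ≤ 0.8 * v * Real.log (ratio κ) := by nlinarith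
  have hp := price_le hκ hx
  have h1 : (1 + price κ) * S.system.card ≤ 1.6 * (w / 4) := by
    have := price_pos hκ
    gcongr
    · linarith
    · linarith
  have h2 : ((κ : ℝ) + 1) * excess κ S.load ≤ (v / 4 + 1) * (0.8 * v) := by
    have := excess_nonneg κ S.load
    gcongr
    linarith
  rw [← hvsq] at h1 ⊢
  nlinarith

/-- The backlog is small if the balance has not grown much since the last idle slot. -/
lemma potential_add_le {κ w : ℕ} (hκ : 144 ≤ κ) (hw : 16 * κ ^ 2 ≤ w)
    (hx : 5 ≤ Real.log κ) (A : Adversary) {ω : Coins}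
    (hω : ∀ (t : ℕ) (j : Packet), (ω (t, j) : ℝ) < 1)
    (harr : ∀ s : ℕ, ((∑ t ∈ Finset.Ico s (s + w), arrivals κ A ω t : ℕ) : ℝ) ≤
      (1 - 5 / Real.log (κ : ℝ)) * (w : ℝ)) {t : ℕ}
    (hbal : ∀ s k, s + k = t → balance κ w A (hist κ A ω (s + k)) - balance κ w A (hist κ A ω s) <
      w / 8 + k / Real.log κ) :
    (replay κ A (hist κ A ω t)).potential κ + depth κ A (hist κ A ω t) + arrivals κ A ω t + κ ≤
      2 * w := by
  obtain ⟨s, hst, hidle, hcount⟩ := exists_idle κ w A ω t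
  obtain ⟨k, rfl⟩ := Nat.exists_eq_add_of_le hst
  have hpot := potential_le_of_idle hκ hw hx A hω hidle
  have h := hbal s k rfl
  have hκ' : (144 : ℝ) ≤ κ := by exact_mod_cast hκ
  have hw' : (16 : ℝ) * κ ^ 2 ≤ w := by exact_mod_cast hw
  have hr : 0 ≤ 1 - 5 / Real.log (κ : ℝ) := by
    rw [sub_nonneg, div_le_one (by linarith)]
    exact hx
  have harr' := sum_arrivals_Ico_le (by nlinarith : 0 < w) hr harr s (k + 1)
  rw [← add_assoc, Finset.sum_Ico_succ_top (Nat.le_add_right s k)] at harr'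
  have hrate := one_add_price_mul_rate_le hκ hx
  have hp := price_pos hκ
  have hmul := mul_le_mul_of_nonneg_left harr' (by linarith : 0 ≤ 1 + price κ)
  have hmul' := mul_le_mul_of_nonneg_right hrate (by positivity : (0 : ℝ) ≤ (k + 1 : ℕ) + w)
  have hx4 : 0 ≤ 4 / Real.log (κ : ℝ) * (1 + w) := by positivity
  have hpa : 0 ≤ price κ * arrivals κ A ω (s + k) := by positivity
  have hcount' : (idleCount κ w A (hist κ A ω (s + k)) : ℝ) ≤
      idleCount κ w A (hist κ A ω s) + 1 := by exact_mod_cast hcount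
  unfold balance at h
  rw [hidle.1, injected_hist, hist_length, hist_length] at h
  push_cast at h hmul hmul'
  have e3 : 3 / Real.log (κ : ℝ) = 3 * (1 / Real.log κ) := by ring
  have e4 : 4 / Real.log (κ : ℝ) = 4 * (1 / Real.log κ) := by ring
  have e1 : (k : ℝ) / Real.log (κ : ℝ) = 1 / Real.log κ * k := by ring
  rw [e3, e1] at h
  rw [e4] at hmul' hx4
  nlinarith

lemma card_inSystem_le {κ w : ℕ} (hκ : 144 ≤ κ) (A : Adversary) {ω : Coins} {t : ℕ}
    (h : (replay κ A (hist κ A ω t)).potential κ + depth κ A (hist κ A ω t) + arrivals κ A ω t + κ ≤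
      2 * w) : (inSystem κ A ω t).card ≤ 2 * w := by
  have hI := (legalHistory_hist (by omega : 2 ≤ κ) A ω t).inv (by omega)
  have h1 := hI.card_sub_le_potential hκ
  have h2 : (2 : ℝ) ≤ depth κ A (hist κ A ω t) := by exact_mod_cast two_le_depth κ A (hist κ A ω t)
  rw [replay_hist, hist_length] at hI
  rw [replay_hist] at h h1
  have h3 : (inSystem κ A ω t).card = (run κ A ω t).system.card + arrivals κ A ω t :=
    hI.card_present A
  have h4 : ((inSystem κ A ω t).card : ℝ) ≤ 2 * w := by
    rw [h3]
    push_cast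
    linarith
  exact_mod_cast h4

lemma idleCount_sub_le (κ w : ℕ) (A : Adversary) (ω : Coins) (s k : ℕ) :
    (idleCount κ w A (hist κ A ω (s + k)) : ℤ) - depth κ A (hist κ A ω (s + k)) -
        netDrift κ A (hist κ A ω (s + k)) ≤
      idleCount κ w A (hist κ A ω s) - depth κ A (hist κ A ω s) - netDrift κ A (hist κ A ω s) := by
  induction k with
  | zero => exact le_rfl
  | succ k ih =>
    rw [← add_assoc, hist_succ]
    exact (idleCount_cons_sub_le κ w A _ _).trans ih

/-- From a state with small potential on, the arrivals do not suffice to fill `5 w ln κ` slots, so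
there are many idle silent slots, which raise all joining probabilities. -/
lemma netDrift_add_four_le {κ w k : ℕ} (hκ : 144 ≤ κ) (hw : 16 * κ ^ 2 ≤ w)
    (hx : 5 ≤ Real.log κ) (hk : 5 * w * Real.log κ ≤ k) (A : Adversary) {ω : Coins}
    (harr : ∀ s : ℕ, ((∑ t ∈ Finset.Ico s (s + w), arrivals κ A ω t : ℕ) : ℝ) ≤
      (1 - 5 / Real.log (κ : ℝ)) * (w : ℝ)) {a : ℕ}
    (ha : (replay κ A (hist κ A ω a)).potential κ + depth κ A (hist κ A ω a) ≤ 2 * w)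
    (hbal : balance κ w A (hist κ A ω (a + k)) - balance κ w A (hist κ A ω a) < w) :
    netDrift κ A (hist κ A ω a) + 4 ≤ netDrift κ A (hist κ A ω (a + k)) := by
  have hI := (legalHistory_hist (by omega : 2 ≤ κ) A ω (a + k)).inv (by omega)
  have hpot := hI.card_sub_le_potential hκ
  have hκ' : (144 : ℝ) ≤ κ := by exact_mod_cast hκ
  have hw' : (16 : ℝ) * κ ^ 2 ≤ w := by exact_mod_cast hw
  have hr : 0 ≤ 1 - 5 / Real.log (κ : ℝ) := by
    rw [sub_nonneg, div_le_one (by linarith)]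
    exact hx
  have harr' := sum_arrivals_Ico_le (by nlinarith : 0 < w) hr harr a k
  have hrate := one_add_price_mul_rate_le hκ hx
  have hp := price_pos hκ
  have hmul := mul_le_mul_of_nonneg_left harr' (by linarith : 0 ≤ 1 + price κ)
  have hmul' := mul_le_mul_of_nonneg_right hrate (by positivity : (0 : ℝ) ≤ (k : ℝ) + w)
  have hx4 : 0 ≤ 4 / Real.log (κ : ℝ) * w := by positivity
  have hgain : 5 * w ≤ k / Real.log (κ : ℝ) := by
    rw [le_div_iff₀ (by linarith)]
    exact hk
  have hcard : (0 : ℝ) ≤ (replay κ A (hist κ A ω (a + k))).system.card := Nat.cast_nonneg _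
  unfold balance at hbal
  rw [injected_hist, hist_length, hist_length] at hbal
  push_cast at hbal hmul hmul'
  have e3 : 3 / Real.log (κ : ℝ) = 3 * (1 / Real.log κ) := by ring
  have e4 : 4 / Real.log (κ : ℝ) = 4 * (1 / Real.log κ) := by ring
  have e1 : (k : ℝ) / Real.log (κ : ℝ) = 1 / Real.log κ * k := by ring
  rw [e3] at hbal
  rw [e4] at hmul' hx4
  rw [e1] at hgain
  have hcount : (4 : ℝ) ≤ idleCount κ w A (hist κ A ω (a + k)) - depth κ A (hist κ A ω (a + k)) -
      idleCount κ w A (hist κ A ω a) := by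
    nlinarith
  have hcount' : 4 ≤ (idleCount κ w A (hist κ A ω (a + k)) : ℤ) - depth κ A (hist κ A ω (a + k)) -
      idleCount κ w A (hist κ A ω a) := by exact_mod_cast hcount
  have := idleCount_sub_le κ w A ω a k
  have := two_le_depth κ A (hist κ A ω a)
  omega

/-! ### Failure probabilities -/

lemma sqrt_window_bounds {κ w : ℕ} (hκ : 144 ≤ κ) (hw : 16 * κ ^ 2 ≤ w) :
    √(w : ℝ) ^ 2 = w ∧ 4 * (κ : ℝ) ≤ √(w : ℝ) ∧ 576 ≤ √(w : ℝ) := by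
  have hκ' : (144 : ℝ) ≤ κ := by exact_mod_cast hκ
  have hw' : (16 : ℝ) * κ ^ 2 ≤ w := by exact_mod_cast hw
  have h : 4 * (κ : ℝ) ≤ √(w : ℝ) := Real.le_sqrt_of_sq_le (by linarith)
  exact ⟨Real.sq_sqrt (Nat.cast_nonneg w), h, by linarith⟩

lemma sqrt_div_five_le {κ w : ℕ} (hκ : 144 ≤ κ) (hw : 16 * κ ^ 2 ≤ w) :
    √(w : ℝ) / 5 ≤ tailRate κ * (w / 8) := by
  obtain ⟨h1, h2, h3⟩ := sqrt_window_bounds hκ hw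
  rw [tailRate, div_mul_div_comm, one_mul, div_le_div_iff₀ (by norm_num) (by positivity)]
  nth_rewrite 2 [← h1]
  nlinarith

/-- The growth bounds of the balance since all earlier slots hold simultaneously with high
probability: the tail probabilities form a geometric series. -/
lemma measure_exists_balance_ge_le {κ w : ℕ} (hκ : 144 ≤ κ) (hw : 16 * κ ^ 2 ≤ w)
    (hx : 5 ≤ Real.log κ) (A : Adversary) (t : ℕ) :
    coinMeasure {ω | ∃ s k, s + k = t ∧ w / 8 + k / Real.log κ ≤
        balance κ w A (hist κ A ω (s + k)) - balance κ w A (hist κ A ω s)} ≤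
      ENNReal.ofReal (w * Real.exp (-(√(w : ℝ) / 5))) := by
  obtain ⟨hv1, hv2, hv3⟩ := sqrt_window_bounds hκ hw
  set v := √(w : ℝ)
  set u := tailRate κ / Real.log κ with hu
  have hβ := tailRate_pos κ
  have hu0 : 0 < u := by positivity
  set r := Real.exp (-u) with hr
  have hr1 : r < 1 := by
    rw [hr, Real.exp_lt_one_iff]
    linarith
  have hsub : {ω | ∃ s k, s + k = t ∧ w / 8 + k / Real.log κ ≤
        balance κ w A (hist κ A ω (s + k)) - balance κ w A (hist κ A ω s)} ⊆
      ⋃ k ∈ Finset.range (t + 1), {ω | w / 8 + k / Real.log κ ≤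
        balance κ w A (hist κ A ω (t - k + k)) - balance κ w A (hist κ A ω (t - k))} := by
    rintro ω ⟨s, k, rfl, h⟩
    simp only [Set.mem_iUnion, Finset.mem_range]
    refine ⟨k, by omega, ?_⟩
    rw [Set.mem_ofPred_eq, Nat.add_sub_cancel]
    exact h
  have hgeom : ∑ k ∈ Finset.range (t + 1), r ^ k ≤ w := by
    have h1 : ∑ k ∈ Finset.range (t + 1), r ^ k ≤ (1 - r)⁻¹ := by
      rw [← tsum_geometric_of_lt_one (Real.exp_pos _).le hr1]
      exact (summable_geometric_of_lt_one (Real.exp_pos _).le hr1).sum_le_tsum _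
        fun _ _ => by positivity
    refine h1.trans ?_
    have h2 : r ≤ 1 / (1 + u) := by
      rw [hr, Real.exp_neg, ← one_div]
      apply one_div_le_one_div_of_le (by positivity)
      linarith [Real.add_one_le_exp u]
    have h3 : 1 + 1 / u ≤ w := by
      have hlog : Real.log κ ≤ κ := (Real.log_le_sub_one_of_pos (by positivity)).trans (by linarith)
      have e : 1 / u = 2 * (κ + 2) * Real.log κ := by
        rw [hu, tailRate]
        field_simp
      rw [e, ← hv1]
      have : 2 * ((κ : ℝ) + 2) * Real.log κ ≤ 2 * (v / 4 + 2) * (v / 4) := by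
        gcongr <;> linarith
      nlinarith
    refine le_trans ?_ h3
    rw [inv_le_comm₀ (by linarith) (by positivity)]
    have e : (1 + 1 / u)⁻¹ = 1 - 1 / (1 + u) := by
      field_simp
      ring
    rw [e]
    linarith
  calc _ ≤ ∑ k ∈ Finset.range (t + 1), coinMeasure {ω | w / 8 + k / Real.log κ ≤
        balance κ w A (hist κ A ω (t - k + k)) - balance κ w A (hist κ A ω (t - k))} :=
        (measure_mono hsub).trans (measure_biUnion_finset_le _ _)
    _ ≤ ∑ k ∈ Finset.range (t + 1), ENNReal.ofReal (Real.exp (-(v / 5)) * r ^ k) := by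
        apply Finset.sum_le_sum
        intro k _
        refine (measure_balance_sub_ge_le hκ hw A (t - k) k _).trans (ENNReal.ofReal_le_ofReal ?_)
        rw [hr, ← Real.exp_nat_mul, ← Real.exp_add]
        apply Real.exp_le_exp.2
        have h1 := sqrt_div_five_le hκ hw
        have h2 : tailRate κ * (w / 8 + k / Real.log κ) = tailRate κ * (w / 8) + k * u := by
          rw [hu]
          ring
        rw [h2]
        linarith
    _ = ENNReal.ofReal (Real.exp (-(v / 5)) * ∑ k ∈ Finset.range (t + 1), r ^ k) := by
        rw [← ENNReal.ofReal_sum_of_nonneg fun _ _ => by positivity, Finset.mul_sum]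
    _ ≤ _ := by
        rw [mul_comm]
        gcongr

/-- Here `exp (√w / 5)` is bounded below by the term of degree `2 (c + 1)` of its series. -/
lemma mul_exp_neg_sqrt_le (c : ℕ) {w : ℕ} (hw : 0 < w) :
    w * Real.exp (-(√(w : ℝ) / 5)) ≤ 25 ^ (c + 1) * (2 * (c + 1)).factorial / (w : ℝ) ^ c := by
  have hw' : (0 : ℝ) < w := by exact_mod_cast hw
  have h := Real.pow_div_factorial_le_exp (√(w : ℝ) / 5) (by positivity) (2 * (c + 1))
  have e : (√(w : ℝ) / 5) ^ (2 * (c + 1)) = (w : ℝ) ^ (c + 1) / 25 ^ (c + 1) := by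
    rw [pow_mul, div_pow, Real.sq_sqrt hw'.le, div_pow]
    norm_num
  rw [e, div_div, div_le_iff₀ (by positivity)] at h
  rw [Real.exp_neg, ← div_eq_mul_inv, div_le_div_iff₀ (by positivity) (by positivity), ← pow_succ']
  linarith

/-- A set that contains the complement of an unlikely set up to a null set is likely; neither of
them needs to be measurable. -/
lemma one_sub_le_measureReal {S Bad : Set Coins} {δ : ℝ} (hδ : 0 ≤ δ)
    (hS : ∀ᵐ ω ∂coinMeasure, ω ∉ Bad → ω ∈ S) (hBad : coinMeasure Bad ≤ ENNReal.ofReal δ) :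
    1 - δ ≤ coinMeasure.real S := by
  have h1 : coinMeasure (Set.univ : Set Coins) ≤ coinMeasure (S ∪ Bad) := by
    apply measure_mono_ae
    filter_upwards [hS] with ω hω _
    by_cases hb : ω ∈ Bad
    · exact .inr hb
    · exact .inl (hω hb)
  rw [measure_univ] at h1
  have h2 : (1 : ℝ≥0∞) ≤ ENNReal.ofReal (coinMeasure.real S + δ) := by
    rw [ENNReal.ofReal_add measureReal_nonneg hδ, ofReal_measureReal]
    exact h1.trans ((measure_union_le _ _).trans (by gcongr))
  rw [ENNReal.one_le_ofReal] at h2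
  linarith

/-- The threshold must be large, since otherwise the arrival rate would be negative. -/
lemma five_le_log {κ w : ℕ} (hκ : 2 ≤ κ) (hw : 16 * κ ^ 2 ≤ w) {A : Adversary}
    (harr : ∀ᵐ ω ∂coinMeasure, ∀ s : ℕ,
        ((∑ t ∈ Finset.Ico s (s + w), arrivals κ A ω t : ℕ) : ℝ) ≤
          (1 - 5 / Real.log (κ : ℝ)) * (w : ℝ)) :
    5 ≤ Real.log κ ∧ 144 ≤ κ := by
  obtain ⟨ω, hω⟩ := harr.exists
  have hlog : 0 < Real.log κ := Real.log_pos (by exact_mod_cast hκ)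
  have hw0 : (0 : ℝ) < w := by
    have : 0 < w := by nlinarith
    exact_mod_cast this
  have h0 := (Nat.cast_nonneg _).trans (hω 0)
  have h1 : 5 / Real.log (κ : ℝ) ≤ 1 := by
    have := nonneg_of_mul_nonneg_left h0 hw0
    linarith
  rw [div_le_one hlog] at h1
  refine ⟨h1, ?_⟩
  rw [Real.le_log_iff_exp_le (by positivity)] at h1
  have h2 : (144 : ℝ) ≤ κ := by
    have h := Real.exp_one_gt_d9.le
    calc (144 : ℝ) ≤ 2.7182818283 ^ 5 := by norm_num
      _ ≤ Real.exp 1 ^ 5 := by gcongr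
      _ = Real.exp 5 := by rw [← Real.exp_nat_mul]; norm_num
      _ ≤ κ := h1
  exact_mod_cast h2

lemma ceil_delay_le {κ w : ℕ} (hκ : 144 ≤ κ) (hw : 16 * κ ^ 2 ≤ w) (hx : 5 ≤ Real.log κ) :
    (⌈5 * w * Real.log κ⌉₊ : ℝ) ≤ 6 * √(κ : ℝ) * w * Real.log w ^ 3 := by
  have hκ' : (144 : ℝ) ≤ κ := by exact_mod_cast hκ
  have hw' : (16 : ℝ) * κ ^ 2 ≤ w := by exact_mod_cast hw
  have hκw : (κ : ℝ) ≤ w := by nlinarith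
  have hlog : Real.log κ ≤ Real.log w := Real.log_le_log (by linarith) hκw
  have h12 := twelve_le_sqrt hκ
  have h1 := (Nat.ceil_lt_add_one (show 0 ≤ 5 * w * Real.log (κ : ℝ) by positivity)).le
  have h2 : (1 : ℝ) ≤ w * Real.log w := by nlinarith
  have h3 : Real.log w ≤ Real.log w ^ 3 := by
    have := pow_le_pow_right₀ (by linarith : 1 ≤ Real.log w) (by norm_num : 1 ≤ 3)
    simpa using this
  calc (⌈5 * w * Real.log κ⌉₊ : ℝ) ≤ 5 * w * Real.log w + w * Real.log w := by
        have : 5 * w * Real.log (κ : ℝ) ≤ 5 * w * Real.log w := by gcongr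
        linarith
    _ = 6 * 1 * w * Real.log w := by ring
    _ ≤ 6 * √(κ : ℝ) * w * Real.log w ^ 3 := by
        have hlw : 0 ≤ Real.log (w : ℝ) := by linarith
        gcongr
        linarith

end CodedRadio

open CodedRadio
theorem theorem1 (c : ℕ) :
    ∃ C : ℝ, 0 < C ∧ ∀ (κ w : ℕ) (A : Adversary), 2 ≤ κ → 16 * κ ^ 2 ≤ w →
      (∀ᵐ ω ∂coinMeasure, ∀ s : ℕ,
        ((∑ t ∈ Finset.Ico s (s + w), arrivals κ A ω t : ℕ) : ℝ) ≤
          (1 - 5 / Real.log (κ : ℝ)) * (w : ℝ)) →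
      (∀ t : ℕ, 1 - C / (w : ℝ) ^ c ≤
        coinMeasure.real {ω | (inSystem κ A ω t).card ≤ 2 * w}) ∧
      (∀ j : Packet, 1 - C / (w : ℝ) ^ c ≤
        coinMeasure.real {ω | j.2 < arrivals κ A ω j.1 →
          ∃ T : ℕ, j ∈ deliveredIn κ A ω T ∧
            (T : ℝ) + 1 - (j.1 : ℝ) ≤ C * √(κ : ℝ) * (w : ℝ) * Real.log (w : ℝ) ^ 3}) := by
  set C₀ : ℝ := 25 ^ (c + 1) * (2 * (c + 1)).factorial with hC₀
  have hC₀pos : 0 < C₀ := by positivity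
  refine ⟨2 * C₀ + 6, by positivity, ?_⟩
  intro κ w A hκ2 hw harr
  obtain ⟨hx, hκ⟩ := five_le_log hκ2 hw harr
  have hw0 : 0 < w := by nlinarith
  have hw1 : (1 : ℝ) ≤ w := by exact_mod_cast hw0
  have hfail := mul_exp_neg_sqrt_le c hw0
  rw [← hC₀] at hfail
  have hBad := measure_exists_balance_ge_le hκ hw hx A
  have hae := harr.and ae_coin_lt_one
  constructor
  · intro t
    have hle : C₀ / (w : ℝ) ^ c ≤ (2 * C₀ + 6) / (w : ℝ) ^ c := by
      gcongr
      linarith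
    refine one_sub_le_measureReal (by positivity) ?_
      ((hBad t).trans (ENNReal.ofReal_le_ofReal (hfail.trans hle)))
    filter_upwards [hae] with ω hω hgood
    refine card_inSystem_le hκ A (potential_add_le hκ hw hx A hω.2 hω.1 fun s k hsk => ?_)
    by_contra hcon
    exact hgood ⟨s, k, hsk, not_lt.1 hcon⟩
  · intro j
    set k := ⌈5 * w * Real.log (κ : ℝ)⌉₊ with hk
    have hbal : coinMeasure {ω | (w : ℝ) ≤ balance κ w A (hist κ A ω (j.1 + k)) -
        balance κ w A (hist κ A ω j.1)} ≤ ENNReal.ofReal (w * Real.exp (-(√(w : ℝ) / 5))) := by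
      refine (measure_balance_sub_ge_le hκ hw A j.1 k w).trans (ENNReal.ofReal_le_ofReal ?_)
      have h1 := sqrt_div_five_le hκ hw
      have h2 : tailRate κ * (w / 8) ≤ tailRate κ * w := by
        have := tailRate_pos κ
        gcongr
        linarith
      calc Real.exp (-(tailRate κ * w)) ≤ 1 * Real.exp (-(√(w : ℝ) / 5)) := by
            rw [one_mul]
            apply Real.exp_le_exp.2
            linarith
        _ ≤ _ := by gcongr
    refine one_sub_le_measureReal (by positivity) ?_
      ((measure_union_le _ _).trans ((add_le_add (hBad j.1) hbal).trans ?_))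
    · filter_upwards [hae] with ω hω hgood hj
      rw [Set.mem_union, not_or] at hgood
      have ha := potential_add_le hκ hw hx A hω.2 hω.1 (t := j.1) fun s k hsk => by
        by_contra hcon
        exact hgood.1 ⟨s, k, hsk, not_lt.1 hcon⟩
      have hdrift := netDrift_add_four_le hκ hw hx (Nat.le_ceil _) A hω.1 (a := j.1)
        (by
          have : (0 : ℝ) ≤ arrivals κ A ω j.1 := Nat.cast_nonneg _
          have : (0 : ℝ) ≤ κ := Nat.cast_nonneg _
          linarith) (not_le.1 hgood.2)
      by_contra hcon
      refine (netDrift_lt_of_not_delivered hκ A hω.2 hj k fun T h1 h2 hT => hcon ⟨T, hT, ?_⟩).not_ge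
        hdrift
      have h3 : (T : ℝ) + 1 ≤ j.1 + k := by exact_mod_cast h2
      have h4 := ceil_delay_le hκ hw hx
      have h5 : 6 * √(κ : ℝ) * w * Real.log w ^ 3 ≤
          (2 * C₀ + 6) * √(κ : ℝ) * w * Real.log w ^ 3 := by
        have := Real.log_nonneg hw1
        gcongr
        linarith
      linarith
    · rw [← ENNReal.ofReal_add (by positivity) (by positivity)]
      apply ENNReal.ofReal_le_ofReal
      have : 2 * (C₀ / (w : ℝ) ^ c) ≤ (2 * C₀ + 6) / (w : ℝ) ^ c := by
        rw [← mul_div_assoc]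
        gcongr
        linarith
      linarith
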